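/- Let $\mathcal S$, $A_\alpha$, $A_\nu$ be finite sets, with $S=|\mathcal S|\ge 1$ and $A=|A_\alpha|\ge 1$. Consider a two-player Markov game with state set $\mathcal S$, attacker actions $A_\alpha$, victim actions $A_\nu$, transition probabilities $P(\cdot\mid s,a,b)$ and initial state distribution $\mu$, played for $H\ge 1$ steps. The victim plays a fixed policy $\pi_\nu:\mathcal S\to\Delta^{A_\nu}$, so the attacker faces the transition probabilities $\sum_b \pi_\nu(b\mid s)P(\cdot\mid s,a,b)$. Attacker policies are maps $\pi:\mathcal S\times[H]\to\Delta^{A_\alpha}$. Put $d^\pi_h(s,a)=\Pr(s_h=s,a_h=a\mid s_1\sim\mu;\pi)$ and, for $r:\mathcal S\times A_\alpha\to\mathbb R$, $J(\pi;r)=\mathbb E_\pi\big[\sum_{h=1}^H r(s_h,a_h)\big]$. For $0<\alpha<1$ let $H_\alpha(d)=\frac1{1-\alpha}\log\sum_i d_i^\alpha$ be the Rényi entropy, and let $\beta=\frac{\alpha}{2(1-\alpha)}$. Exploration: let $\pi^{(h)}\in\arg\max_\pi H_\alpha(d^\pi_h)$ for $h\in[H]$. The dataset $\mathcal M$ consists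 of $M$ independent trajectories $(s_1,a_1,\dots,s_H,a_H)$, each collected by drawing $h\in[H]$ uniformly at random and executing $\pi^{(h)}$ against the victim. Observation: the attacker also holds a finite, possibly random, record of pairs (state, victim action). No assumption is made on how the record was obtained; it may depend on $\mathcal M$. Let $\hat\pi_\nu(s)_i$ be the fraction of recorded actions in state $s$ that equal $i$. The victim's empirical entropy is either the Shannon entropy $\hat H^\nu(s)=-\sum_i\hat\pi_\nu(s)_i\log\hat\pi_\nu(s)_i$ or the Rényi entropy of order $\frac12$, $\hat H^\nu(s)=2\log\sum_i\hat\pi_\nu(s)_i^{1/2}$; put $\hat H^\nu(s)=0$ if $s$ does not occur in the record. Let $R>0$ be a number such that always $\hat H^\nu(s)\le R$ for all $s$. (For example, $R=\log|A_\nu|$ if $|A_\nu|\ge 2$; $R=1$ is the case of rewards in $[0,1]$.) Claim: there is an absolute constant $c>0$ such that for all $\mathcal S,A_\alpha,H,M$ as above there is a planning algorithm, i.e. a map that takes a dataset of $M$ trajectories and a reward function to an attacker policy and does not know the game, the victim's policy or the parameters $\alpha,\epsilon,p,R$, with the following property. For every game and victim policy as above (with any $A_\nu$), all $0<\alpha<1$,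 $\epsilon>0$, $0<p<1$, every $R$ and every choice of $\pi^{(1)},\dots,\pi^{(H)}$ as above, if $$M\ \ge\ c\left(\frac{H^2SA}{\epsilon/R}\right)^{2(\beta+1)}\frac HA\,\log\left(\frac{SAH}{p\,\epsilon/R}\right),$$ then with probability at least $1-p$ the output $\hat\pi$ of the planning algorithm on $\mathcal M$ and the reward function $\hat H^\nu$ is $3\epsilon$-optimal: $$J(\pi^*;\hat H^\nu)-J(\hat\pi;\hat H^\nu)\le 3\epsilon,\qquad\text{where } J(\pi^*;\hat H^\nu)=\max_\pi J(\pi;\hat H^\nu).$$ -/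

import Mathlib

noncomputable section

/-- A finite two-player Markov game with initial state distribution: `S` is the state set,
`A` the attacker's action set, `B` the victim's action set. The attacker never uses
`victimReward`. -/
structure MarkovGame (S A B : Type*) [Fintype S] where
  init : stdSimplex ℝ S
  trans : S → A → B → stdSimplex ℝ S
  victimReward : S → A → B → ℝ

/-- A (step-dependent, randomized) policy of the attacker, `S × [H] → Δ^A`.
Steps are numbered `0, …, H - 1`. -/
abbrev Policy (S A : Type*) [Fintype A] (H : ℕ) : Type _ := Fin H → S → stdSimplex ℝ A

/-- A trajectory `(s_h, a_h)` for `h = 0, …, H - 1`, as recorded by the attacker. -/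
abbrev Trajectory (S A : Type*) (H : ℕ) : Type _ := Fin H → S × A

/-- Rényi entropy of order `α` of a vector of probabilities. -/
def renyiEntropy {ι : Type*} [Fintype ι] (α : ℝ) (d : ι → ℝ) : ℝ :=
  1 / (1 - α) * Real.log (∑ i, d i ^ α)

/-- Shannon entropy of a vector of probabilities. -/
def shannonEntropy {ι : Type*} [Fintype ι] (d : ι → ℝ) : ℝ :=
  -∑ i, d i * Real.log (d i)

/-- The two entropies used for the victim: Shannon, and Rényi of order `1/2`. -/
inductive EntropyKind where
  | shannon
  | renyiHalf

/-- The entropy of the chosen kind. -/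
def EntropyKind.entropy {ι : Type*} [Fintype ι] : EntropyKind → (ι → ℝ) → ℝ
  | .shannon => shannonEntropy
  | .renyiHalf => renyiEntropy (1 / 2)

section Game

variable {S A B : Type*} [Fintype S] [Fintype A] [Fintype B] {H : ℕ}

/-- Transition probabilities `P(s' | s, a)` seen by the attacker while the victim plays the
fixed policy `ν`: the victim's action is averaged out. -/
def attackerTrans (G : MarkovGame S A B) (ν : S → stdSimplex ℝ B) (s : S) (a : A) (s' : S) : ℝ :=
  ∑ b, (ν s).1 b * (G.trans s a b).1 s'

/-- The probability of the trajectory `τ` when the attacker plays `π` against `ν`. -/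
def trajProb (G : MarkovGame S A B) (ν : S → stdSimplex ℝ B) (π : Policy S A H)
    (τ : Trajectory S A H) : ℝ :=
  ∏ h : Fin H,
    (if h.1 = 0 then G.init.1 (τ h).1
      else
        attackerTrans G ν (τ ⟨h.1 - 1, lt_of_le_of_lt (Nat.sub_le _ _) h.2⟩).1
          (τ ⟨h.1 - 1, lt_of_le_of_lt (Nat.sub_le _ _) h.2⟩).2 (τ h).1)
      * (π h (τ h).1).1 (τ h).2

/-- The occupancy `d^π_h(s, a) = Pr(s_h = s, a_h = a)`. -/
def occupancy (G : MarkovGame S A B) (ν : S → stdSimplex ℝ B) (π : Policy S A H) (h : Fin H)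
    (x : S × A) : ℝ :=
  ∑ τ : Trajectory S A H, Set.indicator {τ' | τ' h = x} (trajProb G ν π) τ

/-- The expected return `J(π; r) = E[∑_h r(s_h, a_h)]`. -/
def expectedReturn (G : MarkovGame S A B) (ν : S → stdSimplex ℝ B) (r : S → A → ℝ)
    (π : Policy S A H) : ℝ :=
  ∑ τ : Trajectory S A H, trajProb G ν π τ * ∑ h, r (τ h).1 (τ h).2

/-- `π^(h)` maximizes the order-`α` Rényi entropy of the step-`h` occupancy, for each `h`. -/
def IsRenyiExploration (G : MarkovGame S A B) (ν : S → stdSimplex ℝ B) (α : ℝ)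
    (ω : Fin H → Policy S A H) : Prop :=
  ∀ (h : Fin H) (π : Policy S A H),
    renyiEntropy α (occupancy G ν π h) ≤ renyiEntropy α (occupancy G ν (ω h) h)

/-- The probability of the dataset `δ` of `M` independent trajectories, each obtained by
drawing `h ∈ [H]` uniformly and executing `π^(h)`. -/
def datasetProb {M : ℕ} (G : MarkovGame S A B) (ν : S → stdSimplex ℝ B)
    (ω : Fin H → Policy S A H) (δ : Fin M → Trajectory S A H) : ℝ :=
  ∏ i, (1 / (H : ℝ)) * ∑ h, trajProb G ν (ω h) (δ i)

end Game

section Empirical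

variable {S B : Type*} [Fintype B] {K : ℕ}

/-- The number of times that, among `K` recorded pairs (state, victim action), the victim was
seen to play `b` in state `s`. -/
def victimCount (obs : Fin K → S × B) (s : S) (b : B) : ℕ :=
  Nat.card {k : Fin K // obs k = (s, b)}

/-- The empirical probability of the victim's action `b` in state `s`
(zero in states that were not observed). -/
def empiricalPolicy (obs : Fin K → S × B) (s : S) (b : B) : ℝ :=
  (victimCount obs s b : ℝ) / ∑ b', (victimCount obs s b' : ℝ)

/-- The victim's empirical entropy (zero in states that were not observed). -/
def empiricalEntropy (κ : EntropyKind) (obs : Fin K → S × B) (s : S) : ℝ :=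
  κ.entropy (empiricalPolicy obs s)

end Empirical

end

/-! The planner estimates the kernel of each step by empirical frequencies and plays the greedy
policy of backward induction in the estimated model. By the telescoping identity
`sum_init_sub_expectedReturn`, its regret is at most two sums of occupancy times |(P̂ - P)V|, where
V is the estimated value function: one along the greedy policy, one along a deterministic optimal
policy. Only the points (s, f s) chosen by a deterministic f matter.

Concentration: V depends on the data and on the reward, so the deviation is controlled uniformly
over all f and all functions with values in [0, 1]. The weighted squared deviation is convex in the
function, so indicators suffice (`exists_vertex_ge`); a grid linearizes the square.
`exists_moment_functional` sums exponential moments over selectors, indicators and grid points, at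
logarithmic cost |S| log(66|A|). A cost linear in |S| rather than |S||A| produces the factor H/A in
the sample size. Uniformity also allows the victim's record to depend on the data.

Coverage: occupancies form a convex set, so a maximizer w of the Rényi entropy satisfies ∑ q w^(α-1)
≤ ∑ w^α ≤ |S||A| for every occupancy q (`IsRenyiExploration.coverage`). Hölder's inequality with
exponent θ = (1-α)/(2-α) then transfers the error bound from w to q
(`sum_mul_abs_le_rpow_mul_rpow`), and 1/θ = 2(β+1) is the exponent in the sample size. -/

noncomputable section

/-! ### Trajectory law, occupancy recursion and convexity of occupancies. -/

section Trajectories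

variable {S A B : Type*} [Fintype S] [Fintype B]

theorem attackerTrans_nonneg (G : MarkovGame S A B) (ν : S → stdSimplex ℝ B) (s : S) (a : A)
    (s' : S) : 0 ≤ attackerTrans G ν s a s' :=
  Finset.sum_nonneg fun b _ => mul_nonneg ((ν s).2.1 b) ((G.trans s a b).2.1 s')

theorem sum_attackerTrans (G : MarkovGame S A B) (ν : S → stdSimplex ℝ B) (s : S) (a : A) :
    ∑ s', attackerTrans G ν s a s' = 1 := by
  unfold attackerTrans
  rw [Finset.sum_comm]
  simp_rw [← Finset.mul_sum, (G.trans s a _).2.2, mul_one]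
  exact (ν s).2.2

variable [Fintype A]

theorem trajProb_nonneg {H : ℕ} (G : MarkovGame S A B) (ν : S → stdSimplex ℝ B)
    (π : Policy S A H) (τ : Trajectory S A H) : 0 ≤ trajProb G ν π τ := by
  refine Finset.prod_nonneg fun h _ => mul_nonneg ?_ ((π h _).2.1 _)
  split_ifs
  · exact G.init.2.1 _
  · exact attackerTrans_nonneg _ _ _ _ _

/-- The expectation of a function of the trajectory. -/
def trajExp {H : ℕ} (G : MarkovGame S A B) (ν : S → stdSimplex ℝ B) (π : Policy S A H)
    (F : Trajectory S A H → ℝ) : ℝ :=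
  ∑ τ, trajProb G ν π τ * F τ

theorem trajProb_snoc {n : ℕ} (G : MarkovGame S A B) (ν : S → stdSimplex ℝ B)
    (π : Policy S A (n + 2)) (τ : Trajectory S A (n + 1)) (x : S × A) :
    trajProb G ν π (Fin.snoc (α := fun _ => S × A) τ x) =
      trajProb G ν (fun i => π i.castSucc) τ *
        (attackerTrans G ν (τ (Fin.last n)).1 (τ (Fin.last n)).2 x.1 *
          (π (Fin.last (n + 1)) x.1).1 x.2) := by
  unfold trajProb
  rw [Fin.prod_univ_castSucc]
  congr 1
  · refine Finset.prod_congr rfl fun i _ => ?_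
    have h1 : (⟨i.castSucc.1 - 1, lt_of_le_of_lt (Nat.sub_le _ _) i.castSucc.2⟩ : Fin (n + 2)) =
        Fin.castSucc ⟨i.1 - 1, lt_of_le_of_lt (Nat.sub_le _ _) i.2⟩ := rfl
    rw [h1]
    simp only [Fin.snoc_castSucc, Fin.val_castSucc]
  · have h1 : (⟨(Fin.last (n + 1)).1 - 1, lt_of_le_of_lt (Nat.sub_le _ _) (Fin.last (n + 1)).2⟩ :
        Fin (n + 2)) = Fin.castSucc (Fin.last n) := rfl
    rw [h1]
    simp only [Fin.snoc_castSucc, Fin.snoc_last]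
    simp

theorem trajExp_snoc {n : ℕ} (G : MarkovGame S A B) (ν : S → stdSimplex ℝ B)
    (π : Policy S A (n + 2)) (F : Trajectory S A (n + 2) → ℝ) :
    trajExp G ν π F = trajExp G ν (fun i => π i.castSucc) fun τ =>
      ∑ x : S × A, attackerTrans G ν (τ (Fin.last n)).1 (τ (Fin.last n)).2 x.1 *
          (π (Fin.last (n + 1)) x.1).1 x.2 * F (Fin.snoc (α := fun _ => S × A) τ x) := by
  unfold trajExp
  rw [← (Fin.snocEquiv fun _ => S × A).sum_comp, Fintype.sum_prod_type, Finset.sum_comm]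
  refine Finset.sum_congr rfl fun τ _ => ?_
  rw [Finset.mul_sum]
  refine Finset.sum_congr rfl fun x _ => ?_
  have : (Fin.snocEquiv fun _ => S × A) (x, τ) = Fin.snoc (α := fun _ => S × A) τ x := rfl
  rw [this, trajProb_snoc]
  ring

theorem sum_attackerTrans_mul_policy (G : MarkovGame S A B) (ν : S → stdSimplex ℝ B)
    (π : S → stdSimplex ℝ A) (x : S × A) :
    ∑ x' : S × A, attackerTrans G ν x.1 x.2 x'.1 * (π x'.1).1 x'.2 = 1 := by
  rw [Fintype.sum_prod_type]
  simp_rw [← Finset.mul_sum, (π _).2.2, mul_one]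
  exact sum_attackerTrans _ _ _ _

/-- The last state-action pair integrates to one, so the horizon can be shortened in inductions. -/
theorem trajExp_castSucc {n : ℕ} (G : MarkovGame S A B) (ν : S → stdSimplex ℝ B)
    (π : Policy S A (n + 2)) (F : Trajectory S A (n + 1) → ℝ) :
    trajExp G ν π (fun τ => F fun i => τ i.castSucc) =
      trajExp G ν (fun i => π i.castSucc) F := by
  rw [trajExp_snoc]
  refine Finset.sum_congr rfl fun τ _ => ?_
  simp only [Fin.snoc_castSucc]
  rw [← Finset.sum_mul, sum_attackerTrans_mul_policy, one_mul]

theorem trajExp_zero {n : ℕ} (G : MarkovGame S A B) (ν : S → stdSimplex ℝ B)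
    (π : Policy S A (n + 1)) (g : S × A → ℝ) :
    trajExp G ν π (fun τ => g (τ 0)) = ∑ x : S × A, G.init.1 x.1 * (π 0 x.1).1 x.2 * g x := by
  induction n with
  | zero =>
    unfold trajExp
    rw [← (Equiv.funUnique (Fin 1) (S × A)).symm.sum_comp]
    refine Finset.sum_congr rfl fun x _ => ?_
    simp [trajProb]
  | succ n ih =>
    have := trajExp_castSucc G ν π (fun τ => g (τ 0))
    simp only [Fin.castSucc_zero] at this
    rw [this, ih]
    rfl

/-- This is the Markov property: later steps are integrated out until step `i.succ` is the last one,
where `trajExp_snoc` applies. -/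
theorem trajExp_succ {n : ℕ} (G : MarkovGame S A B) (ν : S → stdSimplex ℝ B)
    (π : Policy S A (n + 1)) (i : Fin n) (g : S × A → S × A → ℝ) :
    trajExp G ν π (fun τ => g (τ i.castSucc) (τ i.succ)) =
      trajExp G ν π (fun τ => ∑ x : S × A,
        attackerTrans G ν (τ i.castSucc).1 (τ i.castSucc).2 x.1 * (π i.succ x.1).1 x.2 *
          g (τ i.castSucc) x) := by
  induction n with
  | zero => exact i.elim0
  | succ n ih =>
    induction i using Fin.lastCases with
    | last =>
      have h1 := trajExp_castSucc G ν π (fun τ => ∑ x : S × A,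
        attackerTrans G ν (τ (Fin.last n)).1 (τ (Fin.last n)).2 x.1 *
          (π (Fin.last (n + 1)) x.1).1 x.2 * g (τ (Fin.last n)) x)
      rw [Fin.succ_last, h1, trajExp_snoc]
      simp only [Fin.snoc_castSucc, Fin.snoc_last]
    | cast j =>
      have h1 := trajExp_castSucc G ν π (fun τ => g (τ j.castSucc) (τ j.succ))
      have h2 := trajExp_castSucc G ν π (fun τ => ∑ x : S × A,
        attackerTrans G ν (τ j.castSucc).1 (τ j.castSucc).2 x.1 *
          (π j.castSucc.succ x.1).1 x.2 * g (τ j.castSucc) x)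
      have h3 := ih (fun i => π i.castSucc) j
      rw [Fin.succ_castSucc] at h2 ⊢
      rw [h1, h2, h3]

theorem trajExp_eq_sum_occupancy {H : ℕ} (G : MarkovGame S A B) (ν : S → stdSimplex ℝ B)
    (π : Policy S A H) (h : Fin H) (g : S × A → ℝ) :
    trajExp G ν π (fun τ => g (τ h)) = ∑ x, occupancy G ν π h x * g x := by
  classical
  unfold trajExp occupancy
  simp_rw [Finset.sum_mul]
  rw [Finset.sum_comm]
  refine Finset.sum_congr rfl fun τ _ => ?_
  simp [Set.indicator_apply, ite_mul]

theorem occupancy_eq_trajExp {H : ℕ} [DecidableEq (S × A)] (G : MarkovGame S A B)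
    (ν : S → stdSimplex ℝ B) (π : Policy S A H) (h : Fin H) (x : S × A) :
    occupancy G ν π h x = trajExp G ν π (fun τ => if τ h = x then 1 else 0) := by
  rw [trajExp_eq_sum_occupancy G ν π h (fun y => if y = x then 1 else 0)]
  simp

theorem occupancy_nonneg {H : ℕ} (G : MarkovGame S A B) (ν : S → stdSimplex ℝ B)
    (π : Policy S A H) (h : Fin H) (x : S × A) : 0 ≤ occupancy G ν π h x :=
  Finset.sum_nonneg fun τ _ => Set.indicator_nonneg (fun τ _ => trajProb_nonneg G ν π τ) τ

theorem occupancy_zero {n : ℕ} (G : MarkovGame S A B) (ν : S → stdSimplex ℝ B)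
    (π : Policy S A (n + 1)) (x : S × A) :
    occupancy G ν π 0 x = G.init.1 x.1 * (π 0 x.1).1 x.2 := by
  classical
  rw [occupancy_eq_trajExp, trajExp_zero G ν π (fun y => if y = x then 1 else 0)]
  simp

theorem occupancy_succ {n : ℕ} (G : MarkovGame S A B) (ν : S → stdSimplex ℝ B)
    (π : Policy S A (n + 1)) (i : Fin n) (x : S × A) :
    occupancy G ν π i.succ x =
      (∑ y, occupancy G ν π i.castSucc y * attackerTrans G ν y.1 y.2 x.1) *
        (π i.succ x.1).1 x.2 := by
  classical
  rw [occupancy_eq_trajExp, trajExp_succ G ν π i (fun _ y => if y = x then 1 else 0)]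
  simp only [mul_ite, mul_one, mul_zero, Finset.sum_ite_eq', Finset.mem_univ, if_true]
  rw [trajExp_eq_sum_occupancy G ν π i.castSucc
    (fun y => attackerTrans G ν y.1 y.2 x.1 * (π i.succ x.1).1 x.2), Finset.sum_mul]
  exact Finset.sum_congr rfl fun y _ => by ring

theorem sum_trajProb {n : ℕ} (G : MarkovGame S A B) (ν : S → stdSimplex ℝ B)
    (π : Policy S A (n + 1)) : ∑ τ, trajProb G ν π τ = 1 := by
  have := trajExp_zero G ν π (fun _ => 1)
  simp only [trajExp, mul_one, Fintype.sum_prod_type, ← Finset.mul_sum, (π 0 _).2.2] at this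
  rw [this, G.init.2.2]

theorem sum_occupancy {n : ℕ} (G : MarkovGame S A B) (ν : S → stdSimplex ℝ B)
    (π : Policy S A (n + 1)) (h : Fin (n + 1)) : ∑ x, occupancy G ν π h x = 1 := by
  have := trajExp_eq_sum_occupancy G ν π h (fun _ => 1)
  simp only [trajExp, mul_one] at this
  rw [← this, sum_trajProb]

theorem trajExp_transition {n : ℕ} (G : MarkovGame S A B) (ν : S → stdSimplex ℝ B)
    (π : Policy S A (n + 1)) (i : Fin n) (g : S × A → S → ℝ) :
    trajExp G ν π (fun τ => g (τ i.castSucc) (τ i.succ).1) =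
      ∑ x, occupancy G ν π i.castSucc x * ∑ s, attackerTrans G ν x.1 x.2 s * g x s := by
  rw [trajExp_succ G ν π i (fun x y => g x y.1), trajExp_eq_sum_occupancy G ν π i.castSucc
    (fun x => ∑ y : S × A, attackerTrans G ν x.1 x.2 y.1 * (π i.succ y.1).1 y.2 * g x y.1)]
  refine Finset.sum_congr rfl fun x _ => ?_
  rw [Fintype.sum_prod_type]
  congr 1
  refine Finset.sum_congr rfl fun s _ => ?_
  dsimp only
  rw [← Finset.sum_mul, ← Finset.mul_sum, (π i.succ s).2.2, mul_one]

theorem expectedReturn_eq_sum_occupancy {H : ℕ} (G : MarkovGame S A B) (ν : S → stdSimplex ℝ B)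
    (r : S → A → ℝ) (π : Policy S A H) :
    expectedReturn G ν r π = ∑ h, ∑ x, occupancy G ν π h x * r x.1 x.2 := by
  simp_rw [← trajExp_eq_sum_occupancy G ν π _ (fun x => r x.1 x.2)]
  unfold trajExp expectedReturn
  rw [Finset.sum_comm]
  exact Finset.sum_congr rfl fun τ _ => Finset.mul_sum _ _ _

/-- Occupancies form a convex set. -/
theorem exists_policy_occupancy_mix {n : ℕ} (G : MarkovGame S A B) (ν : S → stdSimplex ℝ B)
    (π π' : Policy S A (n + 1)) {t : ℝ} (ht0 : 0 ≤ t) (ht1 : t ≤ 1) :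
    ∃ σ : Policy S A (n + 1), ∀ h x,
      occupancy G ν σ h x = (1 - t) * occupancy G ν π h x + t * occupancy G ν π' h x := by
  classical
  set D : Fin (n + 1) → S × A → ℝ := fun h x =>
    (1 - t) * occupancy G ν π h x + t * occupancy G ν π' h x with hD
  have hD0 : ∀ h x, 0 ≤ D h x := fun h x =>
    add_nonneg (mul_nonneg (by linarith) (occupancy_nonneg _ _ _ _ _))
      (mul_nonneg ht0 (occupancy_nonneg _ _ _ _ _))
  set m : Fin (n + 1) → S → ℝ := fun h s => ∑ a, D h (s, a) with hm
  have hm0 : ∀ h s, 0 ≤ m h s := fun h s => Finset.sum_nonneg fun a _ => hD0 h (s, a)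
  -- The conditional law of the action under the mixture. In states of mass zero any choice works,
  -- since `D` vanishes there.
  let σ : Policy S A (n + 1) := fun h s =>
    if hs : m h s = 0 then π h s
    else ⟨fun a => D h (s, a) / m h s, fun a => div_nonneg (hD0 _ _) (hm0 _ _), by
      rw [← Finset.sum_div]; exact div_self hs⟩
  have hσ : ∀ h s a, m h s * (σ h s).1 a = D h (s, a) := by
    intro h s a
    by_cases hs : m h s = 0
    · have := (Finset.sum_eq_zero_iff_of_nonneg fun a _ => hD0 h (s, a)).1 hs a (Finset.mem_univ a)
      rw [this, hs, zero_mul]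
    · simp only [σ, dif_neg hs]
      exact mul_div_cancel₀ _ hs
  refine ⟨σ, fun h => ?_⟩
  change ∀ x, occupancy G ν σ h x = D h x
  induction h using Fin.induction with
  | zero =>
    rintro ⟨s, a⟩
    have : m 0 s = G.init.1 s := by
      simp only [hm, hD, occupancy_zero, Finset.sum_add_distrib, ← Finset.mul_sum, (π 0 s).2.2,
        (π' 0 s).2.2]
      ring
    rw [occupancy_zero, ← hσ, this]
  | succ i ih =>
    rintro ⟨s, a⟩
    -- The state marginal depends linearly on the preceding occupancy, so the mixture obeys the same
    -- recursion as `σ`.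
    have : m i.succ s = ∑ y, D i.castSucc y * attackerTrans G ν y.1 y.2 s := by
      simp only [hm, hD, occupancy_succ, Finset.sum_add_distrib, ← Finset.mul_sum,
        (π i.succ s).2.2, (π' i.succ s).2.2, add_mul, mul_assoc, mul_one]
    rw [occupancy_succ, ← hσ, this]
    simp only [ih]

end Trajectories

/-! ### Grid rounding, one-step exponential moments, and the empirical kernel. -/

section Concentration

/-- Rounding toward zero never overshoots, hence m² ≤ my; it loses less than one, and (|m| + 1)² ≤
2m² + 2. -/
theorem exists_int_round_toward_zero (y : ℝ) :
    ∃ m : ℤ, |(m : ℝ)| ≤ |y| ∧ (m : ℝ) ^ 2 ≤ m * y ∧ y ^ 2 ≤ 2 * (m : ℝ) ^ 2 + 2 := by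
  rcases le_total 0 y with hy | hy
  · have h0 : (0 : ℝ) ≤ ⌊y⌋ := by exact_mod_cast Int.floor_nonneg.2 hy
    have h1 := Int.floor_le y
    have h2 := Int.lt_floor_add_one y
    refine ⟨⌊y⌋, ?_, by nlinarith, by nlinarith [sq_nonneg ((⌊y⌋ : ℝ) - 1)]⟩
    rw [abs_of_nonneg h0, abs_of_nonneg hy]
    exact h1
  · have h0 : (⌈y⌉ : ℝ) ≤ 0 := by exact_mod_cast Int.ceil_nonpos.2 hy
    have h1 := Int.le_ceil y
    have h2 := Int.ceil_lt_add_one y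
    refine ⟨⌈y⌉, ?_, by nlinarith, by nlinarith [sq_nonneg ((⌈y⌉ : ℝ) + 1)]⟩
    rw [abs_of_nonpos h0, abs_of_nonpos hy]
    linarith

/-- The grid point `m / √u`, cut off outside `[-1, 1]`. -/
def gridPoint (u : ℝ) (m : ℤ) : ℝ :=
  if |(m : ℝ)| ≤ √u then m / √u else 0

theorem abs_gridPoint_le_one (u : ℝ) (m : ℤ) : |gridPoint u m| ≤ 1 := by
  unfold gridPoint
  split_ifs with h
  · rw [abs_div, abs_of_nonneg (Real.sqrt_nonneg u)]
    exact div_le_one_of_le₀ h (Real.sqrt_nonneg u)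
  · simp

/-- The grid point lies between 0 and x, and the spacing 1/√u turns its weighted square into m²,
which can be summed with Gaussian weights independently of u. -/
theorem exists_gridPoint_approx {u x : ℝ} (hu : 0 ≤ u) (hx : |x| ≤ 1) :
    ∃ m : ℤ, |(m : ℝ)| ≤ √u ∧ gridPoint u m ^ 2 ≤ gridPoint u m * x ∧
      u * gridPoint u m ^ 2 = m ^ 2 ∧ u * x ^ 2 ≤ 2 * (m : ℝ) ^ 2 + 2 := by
  rcases hu.eq_or_lt with rfl | hu
  · exact ⟨0, by simp, by simp [gridPoint], by simp, by simp⟩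
  · obtain ⟨m, h1, h2, h3⟩ := exists_int_round_toward_zero (√u * x)
    have hs : 0 < √u := Real.sqrt_pos.2 hu
    have hss : √u ^ 2 = u := Real.sq_sqrt hu.le
    have hm : |(m : ℝ)| ≤ √u := h1.trans (by
      rw [abs_mul, abs_of_pos hs]; nlinarith)
    refine ⟨m, hm, ?_, ?_, ?_⟩
    · rw [gridPoint, if_pos hm, div_pow, div_mul_eq_mul_div, div_le_div_iff₀ (by positivity) hs]
      nlinarith
    · rw [gridPoint, if_pos hm, div_pow, hss]
      field_simp
    · rw [mul_pow, hss] at h3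
      exact h3

theorem sum_exp_neg_sq_le (K : ℕ) :
    ∑ m ∈ Finset.Icc (-(K : ℤ)) K, Real.exp (-(m : ℝ) ^ 2 / 16) ≤ 33 := by
  -- Equality holds at K = 0. Since e^(1/16) ≥ 1 + 1/16, the right side grows by at least
  -- 2e^(-(K+1)/16), which pays for the two new terms.
  have key : ∀ K : ℕ, ∑ m ∈ Finset.Icc (-(K : ℤ)) K, Real.exp (-(m : ℝ) ^ 2 / 16) ≤
      33 - 32 * Real.exp (-(K : ℝ) / 16) := by
    intro K
    induction K with
    | zero => simp; norm_num
    | succ K ih =>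
      have h1 : Finset.Icc (-((K + 1 : ℕ) : ℤ)) ((K + 1 : ℕ) : ℤ) =
          insert (-((K : ℤ) + 1)) (insert ((K : ℤ) + 1) (Finset.Icc (-(K : ℤ)) K)) := by
        ext m
        simp only [Finset.mem_Icc, Finset.mem_insert]
        push_cast
        omega
      rw [h1, Finset.sum_insert (by simp only [Finset.mem_Icc, Finset.mem_insert]; omega),
        Finset.sum_insert (by simp only [Finset.mem_Icc]; omega)]
      push_cast
      have h2 : Real.exp (-((K : ℝ) + 1) ^ 2 / 16) ≤ Real.exp (-((K : ℝ) + 1) / 16) := by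
        apply Real.exp_le_exp.2
        have : (0 : ℝ) ≤ K := K.cast_nonneg
        nlinarith
      have h3 : (1 + 1 / 16) * Real.exp (-((K : ℝ) + 1) / 16) ≤ Real.exp (-(K : ℝ) / 16) := by
        have : Real.exp (-(K : ℝ) / 16) = Real.exp (1 / 16) * Real.exp (-((K : ℝ) + 1) / 16) := by
          rw [← Real.exp_add]; congr 1; ring
        rw [this]
        have := Real.add_one_le_exp (1 / 16 : ℝ)
        exact mul_le_mul_of_nonneg_right (by linarith) (Real.exp_pos _).le
      have h4 : -(-((K : ℝ) + 1)) ^ 2 = -((K : ℝ) + 1) ^ 2 := by ring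
      have h5 : (-1 + -(K : ℝ)) = -((K : ℝ) + 1) := by ring
      simp only [h4] at *
      linarith
  have := key K
  have := Real.exp_pos (-(K : ℝ) / 16)
  linarith

theorem exp_le_one_add_add_sq {z : ℝ} (hz : |z| ≤ 1) : Real.exp z ≤ 1 + z + z ^ 2 := by
  have := (abs_le.1 (Real.abs_exp_sub_one_sub_id_le hz)).2
  linarith

/-- A one-step exponential moment bound for a centred bounded variable. -/
theorem sum_mul_exp_centered_le {S : Type*} [Fintype S] (P G : S → ℝ) (t : ℝ)
    (hP : ∀ s, 0 ≤ P s) (hP1 : ∑ s, P s = 1) (hG : ∀ s, G s ∈ Set.Icc (0 : ℝ) 1) (ht : |t| ≤ 1) :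
    ∑ s, P s * Real.exp ((t * (G s - ∑ s', P s' * G s') - t ^ 2) / 2) ≤ 1 - t ^ 2 / 8 := by
  set m := ∑ s', P s' * G s' with hm
  have hm0 : 0 ≤ m := Finset.sum_nonneg fun s _ => mul_nonneg (hP s) (hG s).1
  have hm1 : m ≤ 1 := by
    rw [← hP1]
    exact Finset.sum_le_sum fun s _ => mul_le_of_le_one_right (hP s) (hG s).2
  have ht2 : t ^ 2 ≤ 1 := by rw [← sq_abs]; nlinarith [abs_nonneg t]
  have h1 : ∀ s, Real.exp (t * (G s - m) / 2) ≤ 1 + t * (G s - m) / 2 + t ^ 2 / 4 := by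
    intro s
    have hd : |G s - m| ≤ 1 := abs_le.2 ⟨by linarith [(hG s).1], by linarith [(hG s).2]⟩
    have hz : |t * (G s - m) / 2| ≤ 1 := by
      rw [abs_div, abs_mul, abs_two]
      nlinarith [abs_nonneg t, abs_nonneg (G s - m)]
    refine (exp_le_one_add_add_sq hz).trans ?_
    have : (G s - m) ^ 2 ≤ 1 := by rw [← sq_abs]; nlinarith [abs_nonneg (G s - m)]
    nlinarith [sq_nonneg t]
  have h2 : ∑ s, P s * (1 + t * (G s - m) / 2 + t ^ 2 / 4) = 1 + t ^ 2 / 4 := by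
    have : ∀ s, P s * (1 + t * (G s - m) / 2 + t ^ 2 / 4) =
        (1 - t * m / 2 + t ^ 2 / 4) * P s + t / 2 * (P s * G s) := fun s => by ring
    simp_rw [this]
    rw [Finset.sum_add_distrib, ← Finset.mul_sum, ← Finset.mul_sum, hP1, ← hm]
    ring
  have h3 : ∀ s, Real.exp ((t * (G s - m) - t ^ 2) / 2) =
      Real.exp (t * (G s - m) / 2) * Real.exp (-(t ^ 2 / 2)) := fun s => by
    rw [← Real.exp_add]; congr 1; ring
  -- Centring removes the linear term. The compensator -t²/2 outweighs the second-order term t²/4,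
  -- and the negative drift left over is the reserve used in `sum_exp_gridExponent_le`.
  calc _ = (∑ s, P s * Real.exp (t * (G s - m) / 2)) * Real.exp (-(t ^ 2 / 2)) := by
        rw [Finset.sum_mul]
        exact Finset.sum_congr rfl fun s _ => by rw [h3, mul_assoc]
    _ ≤ (1 + t ^ 2 / 4) * Real.exp (-(t ^ 2 / 2)) := by
        rw [← h2]
        exact mul_le_mul_of_nonneg_right
          (Finset.sum_le_sum fun s _ => mul_le_mul_of_nonneg_left (h1 s) (hP s))
          (Real.exp_pos _).le
    _ ≤ Real.exp (t ^ 2 / 4) * Real.exp (-(t ^ 2 / 2)) := by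
        refine mul_le_mul_of_nonneg_right ?_ (Real.exp_pos _).le
        linarith [Real.add_one_le_exp (t ^ 2 / 4)]
    _ = Real.exp (-(t ^ 2 / 4)) := by rw [← Real.exp_add]; congr 1; ring
    _ ≤ 1 + -(t ^ 2 / 4) + (-(t ^ 2 / 4)) ^ 2 :=
        exp_le_one_add_add_sq (by rw [abs_neg, abs_of_nonneg (by positivity)]; linarith)
    _ ≤ 1 - t ^ 2 / 8 := by nlinarith [sq_nonneg t]

/-- A convex function on the cube is bounded by one of its values at the vertices. -/
theorem exists_vertex_ge {S : Type*} [Fintype S] {g : (S → ℝ) → ℝ}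
    (hg : ConvexOn ℝ Set.univ g) {G : S → ℝ} (hG : ∀ s, G s ∈ Set.Icc (0 : ℝ) 1) :
    ∃ U : S → Bool, g G ≤ g (fun s => if U s then 1 else 0) := by
  classical
  have hmem : G ∈ convexHull ℝ (Set.pi Set.univ fun _ : S => ({0, 1} : Set ℝ)) := by
    rw [convexHull_pi]
    intro s _
    rw [convexHull_pair, segment_eq_Icc zero_le_one]
    exact hG s
  obtain ⟨V, hV, hle⟩ := (hg.subset (Set.subset_univ _) (convex_convexHull ℝ _)).exists_ge_of_mem_convexHull
    (subset_convexHull ℝ _) hmem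
  refine ⟨fun s => decide (V s = 1), hle.trans_eq ?_⟩
  congr 1
  ext s
  rcases hV s (Set.mem_univ s) with h | h
  · simp [h]
  · have : V s = 1 := h
    simp [this]

/-- The empirical transition probabilities (zero at points that do not occur). -/
def empiricalKernel {T X S : Type*} {M : ℕ} (x : T → X) (y : T → S) (δ : Fin M → T) (z : X)
    (s : S) : ℝ := by
  classical
  exact (∑ j, if x (δ j) = z ∧ y (δ j) = s then 1 else 0) / ∑ j, if x (δ j) = z then 1 else 0

section

variable {T X S : Type*} {M : ℕ} (x : T → X) (y : T → S) (δ : Fin M → T) (z : X)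

theorem empiricalKernel_nonneg (s : S) : 0 ≤ empiricalKernel x y δ z s := by
  classical
  exact div_nonneg (Finset.sum_nonneg fun j _ => by split_ifs <;> simp)
    (Finset.sum_nonneg fun j _ => by split_ifs <;> simp)

theorem sum_empiricalKernel_mul [Fintype S] [DecidableEq X] (G : S → ℝ) :
    ∑ s, empiricalKernel x y δ z s * G s =
      (∑ j, if x (δ j) = z then G (y (δ j)) else 0) / ∑ j, if x (δ j) = z then 1 else 0 := by
  classical
  have : ∀ s, empiricalKernel x y δ z s * G s =
      (∑ j, if x (δ j) = z ∧ y (δ j) = s then G s else 0) /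
        ∑ j, if x (δ j) = z then 1 else 0 := fun s => by
    unfold empiricalKernel
    rw [div_mul_eq_mul_div, Finset.sum_mul]
    congr 1
    · exact Finset.sum_congr rfl fun j _ => by split_ifs <;> simp
    · congr!
  simp_rw [this]
  rw [← Finset.sum_div, Finset.sum_comm]
  congr 1
  refine Finset.sum_congr rfl fun j _ => ?_
  by_cases h : x (δ j) = z <;> simp [h]

theorem sum_empiricalKernel_le_one [Fintype S] : ∑ s, empiricalKernel x y δ z s ≤ 1 := by
  classical
  have := sum_empiricalKernel_mul x y δ z (fun _ => 1)
  simp only [mul_one] at this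
  rw [this]
  exact div_self_le_one _

/-- The deviation `(P̂ - P) G` of the empirical kernel from a kernel `P`. -/
def kernelDeviation [Fintype S] (P : X → S → ℝ) (G : S → ℝ) : ℝ :=
  ∑ s, empiricalKernel x y δ z s * G s - ∑ s, P z s * G s

theorem abs_kernelDeviation_le_one [Fintype S] {P : X → S → ℝ} {G : S → ℝ} (hP : ∀ s, 0 ≤ P z s)
    (hP1 : ∑ s, P z s = 1) (hG : ∀ s, G s ∈ Set.Icc (0 : ℝ) 1) :
    |kernelDeviation x y δ z P G| ≤ 1 := by
  have h1 : ∀ Q : S → ℝ, (∀ s, 0 ≤ Q s) → ∑ s, Q s ≤ 1 →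
      0 ≤ ∑ s, Q s * G s ∧ ∑ s, Q s * G s ≤ 1 := fun Q hQ hQ1 =>
    ⟨Finset.sum_nonneg fun s _ => mul_nonneg (hQ s) (hG s).1,
      (Finset.sum_le_sum fun s _ => mul_le_of_le_one_right (hQ s) (hG s).2).trans hQ1⟩
  have h2 := h1 _ (empiricalKernel_nonneg x y δ z) (sum_empiricalKernel_le_one x y δ z)
  have h3 := h1 _ hP hP1.le
  exact abs_le.2 ⟨by unfold kernelDeviation; linarith, by unfold kernelDeviation; linarith⟩

/-- Clearing the random denominator gives a sum over samples, the form whose exponential moments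
factorize. -/
theorem count_mul_kernelDeviation [Fintype S] [DecidableEq X] (P : X → S → ℝ) (G : S → ℝ) :
    (∑ j, if x (δ j) = z then 1 else 0) * kernelDeviation x y δ z P G =
      ∑ j, if x (δ j) = z then G (y (δ j)) - ∑ s, P z s * G s else 0 := by
  unfold kernelDeviation
  rw [sum_empiricalKernel_mul]
  have h : ∀ j, (if x (δ j) = z then G (y (δ j)) - ∑ s, P z s * G s else 0) =
      (if x (δ j) = z then G (y (δ j)) else 0) -
        (if x (δ j) = z then 1 else 0) * ∑ s, P z s * G s := fun j => by
    split_ifs <;> simp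
  simp_rw [h]
  rw [Finset.sum_sub_distrib, ← Finset.sum_mul, mul_sub]
  congr 1
  -- At an unvisited point the quotient is 0/0 = 0, and both sides vanish.
  by_cases h0 : (∑ j, if x (δ j) = z then (1 : ℝ) else 0) = 0
  · rw [h0, zero_mul]
    have h1 := (Finset.sum_eq_zero_iff_of_nonneg
      (fun j _ => by split_ifs <;> simp : ∀ j ∈ Finset.univ,
        (0 : ℝ) ≤ if x (δ j) = z then 1 else 0)).1 h0
    refine (Finset.sum_eq_zero fun j hj => ?_).symm
    have := h1 j hj
    by_cases hx : x (δ j) = z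
    · simp [hx] at this
    · simp [hx]
  · exact mul_div_cancel₀ _ h0

/-- The deviation is linear in the function; this feeds `exists_vertex_ge`. -/
theorem convexOn_sum_mul_kernelDeviation_sq [Fintype S] {ι : Type*} [Fintype ι] (u : ι → ℝ)
    (hu : ∀ i, 0 ≤ u i) (z : ι → X) (P : X → S → ℝ) :
    ConvexOn ℝ Set.univ fun G : S → ℝ =>
      ∑ i, u i * kernelDeviation x y δ (z i) P G ^ 2 := by
  refine ⟨convex_univ, fun G₁ _ G₂ _ a b ha hb hab => ?_⟩
  have hlin : ∀ i, kernelDeviation x y δ (z i) P (a • G₁ + b • G₂) =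
      a * kernelDeviation x y δ (z i) P G₁ + b * kernelDeviation x y δ (z i) P G₂ := by
    intro i
    simp only [kernelDeviation, mul_sub, Finset.mul_sum, Pi.add_apply, Pi.smul_apply, smul_eq_mul,
      mul_add, Finset.sum_add_distrib, mul_left_comm a, mul_left_comm b]
    ring
  simp only [smul_eq_mul, Finset.mul_sum, ← Finset.sum_add_distrib, hlin]
  refine Finset.sum_le_sum fun i _ => ?_
  have hb' : b = 1 - a := by linarith
  subst hb'
  nlinarith [mul_nonneg (hu i) (mul_nonneg (mul_nonneg ha hb)
    (sq_nonneg (kernelDeviation x y δ (z i) P G₁ - kernelDeviation x y δ (z i) P G₂)))]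

end

end Concentration

/-! ### Uniform exponential moment bound for the empirical kernel. -/

section Moments

variable {T S A : Type*} [Fintype S] [Fintype A] {M : ℕ}

/-- Grid points with scales `M μ`, placed along the graph of `f`. -/
def gridWeight (M : ℕ) (μ : S × A → ℝ) (f : S → A) (m : S → ℤ) (z : S × A) : ℝ := by
  classical
  exact if f z.1 = z.2 then gridPoint (M * μ z) (m z.1) else 0

/-- The exponent of the moment functional at the grid weights `t`. -/
def gridExponent (x : T → S × A) (y : T → S) (μ : S × A → ℝ) (P : S × A → S → ℝ)
    (δ : Fin M → T) (G : S → ℝ) (t : S × A → ℝ) : ℝ :=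
  M * (∑ z, μ z * t z ^ 2) / 8 +
    ∑ j, (t (x (δ j)) * (G (y (δ j)) - ∑ s, P (x (δ j)) s * G s) - t (x (δ j)) ^ 2) / 2

/-- By independence the moment is an M-th power whose base is at most e^(-q/8), exactly cancelling
the prefactor e^(Mq/8). The random visit counts need no separate treatment. -/
theorem sum_exp_gridExponent_le [Fintype T] (ρ : T → ℝ) (x : T → S × A) (y : T → S) (μ : S × A → ℝ)
    (P : S × A → S → ℝ) (hρ0 : ∀ τ, 0 ≤ ρ τ) (hμ0 : ∀ z, 0 ≤ μ z) (hμ1 : ∑ z, μ z = 1)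
    (hP0 : ∀ z s, 0 ≤ P z s) (hP1 : ∀ z, ∑ s, P z s = 1)
    (hρ : ∀ g : S × A → S → ℝ, ∑ τ, ρ τ * g (x τ) (y τ) = ∑ z, μ z * ∑ s, P z s * g z s)
    {G : S → ℝ} (hG : ∀ s, G s ∈ Set.Icc (0 : ℝ) 1) {t : S × A → ℝ} (ht : ∀ z, |t z| ≤ 1) :
    ∑ δ : Fin M → T, (∏ j, ρ (δ j)) * Real.exp (gridExponent x y μ P δ G t) ≤ 1 := by
  set q := ∑ z, μ z * t z ^ 2 with hq
  have h1 : ∀ δ : Fin M → T, (∏ j, ρ (δ j)) * Real.exp (gridExponent x y μ P δ G t) =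
      Real.exp (M * q / 8) * ∏ j, ρ (δ j) * Real.exp ((t (x (δ j)) *
        (G (y (δ j)) - ∑ s, P (x (δ j)) s * G s) - t (x (δ j)) ^ 2) / 2) := fun δ => by
    rw [gridExponent, Real.exp_add, Real.exp_sum, Finset.prod_mul_distrib]
    ring
  simp_rw [h1]
  rw [← Finset.mul_sum, ← Fintype.sum_pow (fun τ => ρ τ * Real.exp ((t (x τ) *
        (G (y τ) - ∑ s, P (x τ) s * G s) - t (x τ) ^ 2) / 2)) M]
  have h2 : ∑ τ, ρ τ * Real.exp ((t (x τ) * (G (y τ) - ∑ s, P (x τ) s * G s) - t (x τ) ^ 2) / 2)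
      ≤ Real.exp (-(q / 8)) := by
    rw [hρ fun z s => Real.exp ((t z * (G s - ∑ s', P z s' * G s') - t z ^ 2) / 2)]
    calc _ ≤ ∑ z, μ z * (1 - t z ^ 2 / 8) := Finset.sum_le_sum fun z _ =>
          mul_le_mul_of_nonneg_left
            (sum_mul_exp_centered_le (P z) G (t z) (hP0 z) (hP1 z) hG (ht z)) (hμ0 z)
      _ = 1 - q / 8 := by
          simp_rw [mul_sub, mul_one, Finset.sum_sub_distrib, hμ1, hq, Finset.sum_div, mul_div_assoc]
      _ ≤ _ := by linarith [Real.add_one_le_exp (-(q / 8))]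
  calc _ ≤ Real.exp (M * q / 8) * Real.exp (-(q / 8)) ^ M :=
        mul_le_mul_of_nonneg_left (pow_le_pow_left₀
          (Finset.sum_nonneg fun τ _ => mul_nonneg (hρ0 τ) (Real.exp_pos _).le) h2 M)
          (Real.exp_pos _).le
    _ = 1 := by
        rw [← Real.exp_nat_mul, ← Real.exp_add]
        convert Real.exp_zero using 2
        ring

/-- With t between 0 and the deviation D, the data part is a sum of count times (tD - t²)/2, hence
nonnegative. The population part is ∑ m²/8; half of it pays for the weights -m²/16, and D² rounding
gives ∑ m²/16 ≥ (∑ MμD² - 2|S|)/32. -/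
theorem exists_gridExponent_ge (x : T → S × A) (y : T → S) (μ : S × A → ℝ)
    (P : S × A → S → ℝ) (hμ0 : ∀ z, 0 ≤ μ z) (hμ1 : ∀ z, μ z ≤ 1)
    (hP0 : ∀ z s, 0 ≤ P z s) (hP1 : ∀ z, ∑ s, P z s = 1) (δ : Fin M → T) (f : S → A)
    {G : S → ℝ} (hG : ∀ s, G s ∈ Set.Icc (0 : ℝ) 1) :
    ∃ m : S → ℤ, (∀ s, m s ∈ Finset.Icc (-(M : ℤ)) M) ∧
      (∑ s, M * μ (s, f s) * kernelDeviation x y δ (s, f s) P G ^ 2) / 32 - Fintype.card S / 16 ≤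
        ∑ s, -(m s : ℝ) ^ 2 / 16 + gridExponent x y μ P δ G (gridWeight M μ f m) := by
  classical
  have hu : ∀ z, 0 ≤ M * μ z := fun z => mul_nonneg M.cast_nonneg (hμ0 z)
  choose m h1 h2 h3 h4 using fun s => exists_gridPoint_approx (hu (s, f s))
    (abs_kernelDeviation_le_one x y δ (s, f s) (hP0 _) (hP1 _) hG)
  refine ⟨m, fun s => ?_, ?_⟩
  · have hM : √(M * μ (s, f s)) ≤ M := by
      rw [Real.sqrt_le_left M.cast_nonneg]
      have : (M : ℝ) ≤ (M : ℝ) ^ 2 := by exact_mod_cast Nat.le_self_pow two_ne_zero M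
      nlinarith [hμ1 (s, f s), (Nat.cast_nonneg M : (0 : ℝ) ≤ M)]
    have := abs_le.1 ((h1 s).trans hM)
    rw [Finset.mem_Icc]
    exact ⟨by exact_mod_cast this.1, by exact_mod_cast this.2⟩
  · set t := gridWeight M μ f m with ht
    have hts : ∀ s, t (s, f s) = gridPoint (M * μ (s, f s)) (m s) := fun s => by
      simp [ht, gridWeight]
    have ht0 : ∀ s a, f s ≠ a → t (s, a) = 0 := fun s a h => by
      simp [ht, gridWeight, h]
    have hsum : ∀ F : S × A → ℝ, (∀ s a, f s ≠ a → F (s, a) = 0) →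
        ∑ z, F z = ∑ s, F (s, f s) := fun F hF => by
      rw [Fintype.sum_prod_type]
      exact Finset.sum_congr rfl fun s _ =>
        Fintype.sum_eq_single (f s) fun a ha => hF s a ha.symm
    have hq : M * (∑ z, μ z * t z ^ 2) = ∑ s, (m s : ℝ) ^ 2 := by
      rw [hsum _ fun s a h => by rw [ht0 s a h]; ring, Finset.mul_sum]
      exact Finset.sum_congr rfl fun s _ => by rw [hts, ← h3 s]; ring
    have hdata : 0 ≤ ∑ j, (t (x (δ j)) * (G (y (δ j)) - ∑ s, P (x (δ j)) s * G s) -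
        t (x (δ j)) ^ 2) / 2 := by
      have hfib : ∀ j, (t (x (δ j)) * (G (y (δ j)) - ∑ s, P (x (δ j)) s * G s) -
          t (x (δ j)) ^ 2) / 2 = ∑ z, (t z * (if x (δ j) = z then G (y (δ j)) - ∑ s, P z s * G s
            else 0) - t z ^ 2 * (if x (δ j) = z then 1 else 0)) / 2 := fun j => by
        rw [Fintype.sum_eq_single (x (δ j)) fun z hz => by simp [hz.symm]]
        simp
      simp_rw [hfib]
      rw [Finset.sum_comm]
      refine Finset.sum_nonneg fun z _ => ?_
      rw [← Finset.sum_div, Finset.sum_sub_distrib, ← Finset.mul_sum, ← Finset.mul_sum,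
        ← count_mul_kernelDeviation]
      have hn : (0 : ℝ) ≤ ∑ j, if x (δ j) = z then 1 else 0 :=
        Finset.sum_nonneg fun j _ => by split_ifs <;> simp
      have ht2 : t z ^ 2 ≤ t z * kernelDeviation x y δ z P G := by
        by_cases hz : f z.1 = z.2
        · have hzz : z = (z.1, f z.1) := by rw [hz]
          rw [hzz, hts]
          exact h2 z.1
        · rw [show t z = 0 from ht0 z.1 z.2 hz]
          simp
      nlinarith
    have h5 : ∑ s, M * μ (s, f s) * kernelDeviation x y δ (s, f s) P G ^ 2 ≤
        2 * ∑ s, (m s : ℝ) ^ 2 + 2 * Fintype.card S := by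
      refine (Finset.sum_le_sum fun s _ => h4 s).trans_eq ?_
      rw [Finset.sum_add_distrib, Finset.mul_sum]
      simp [mul_comm]
    have h6 : ∑ s, -(m s : ℝ) ^ 2 / 16 = -(∑ s, (m s : ℝ) ^ 2) / 16 := by
      rw [← Finset.sum_div, Finset.sum_neg_distrib]
    rw [gridExponent, hq, h6]
    linarith

/-- A functional of the data with bounded expectation which dominates the exponential of the
`μ`-weighted squared deviation of the empirical kernel, uniformly over deterministic choices of the
action and over functions with values in `[0, 1]`. -/
theorem exists_moment_functional [Fintype T] (M : ℕ) (ρ : T → ℝ) (x : T → S × A) (y : T → S) (μ : S × A → ℝ)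
    (P : S × A → S → ℝ) (hρ0 : ∀ τ, 0 ≤ ρ τ) (hμ0 : ∀ z, 0 ≤ μ z) (hμ1 : ∑ z, μ z = 1)
    (hP0 : ∀ z s, 0 ≤ P z s) (hP1 : ∀ z, ∑ s, P z s = 1)
    (hρ : ∀ g : S × A → S → ℝ, ∑ τ, ρ τ * g (x τ) (y τ) = ∑ z, μ z * ∑ s, P z s * g z s) :
    ∃ Φ : (Fin M → T) → ℝ, (∀ δ, 0 ≤ Φ δ) ∧
      ∑ δ, (∏ j, ρ (δ j)) * Φ δ ≤ (66 * Fintype.card A : ℝ) ^ Fintype.card S ∧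
      ∀ (δ : Fin M → T) (f : S → A) (G : S → ℝ), (∀ s, G s ∈ Set.Icc (0 : ℝ) 1) →
        Real.exp ((∑ s, M * μ (s, f s) * kernelDeviation x y δ (s, f s) P G ^ 2) / 32 -
          Fintype.card S / 16) ≤ Φ δ := by
  classical
  let ind : (S → Bool) → S → ℝ := fun U s => if U s then 1 else 0
  have hind : ∀ U s, ind U s ∈ Set.Icc (0 : ℝ) 1 := fun U s => by
    simp only [ind]; split_ifs <;> simp
  let grid : Finset (S → ℤ) := Fintype.piFinset fun _ => Finset.Icc (-(M : ℤ)) M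
  let Φ : (Fin M → T) → ℝ := fun δ => ∑ f : S → A, ∑ U : S → Bool, ∑ m ∈ grid,
    Real.exp (∑ s, -(m s : ℝ) ^ 2 / 16) *
      Real.exp (gridExponent x y μ P δ (ind U) (gridWeight M μ f m))
  have hpos : ∀ (δ : Fin M → T) f U m, 0 ≤ Real.exp (∑ s, -(m s : ℝ) ^ 2 / 16) *
      Real.exp (gridExponent x y μ P δ (ind U) (gridWeight M μ f m)) := fun δ f U m => by positivity
  refine ⟨Φ, fun δ => Finset.sum_nonneg fun f _ => Finset.sum_nonneg fun U _ =>
    Finset.sum_nonneg fun m _ => hpos δ f U m, ?_, fun δ f G hG => ?_⟩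
  · have hle : ∀ (f : S → A) (U : S → Bool) (m : S → ℤ), ∑ δ : Fin M → T, (∏ j, ρ (δ j)) *
        Real.exp (gridExponent x y μ P δ (ind U) (gridWeight M μ f m)) ≤ 1 := fun f U m =>
      sum_exp_gridExponent_le ρ x y μ P hρ0 hμ0 hμ1 hP0 hP1 hρ (hind U) fun z => by
        unfold gridWeight
        split_ifs
        · exact abs_gridPoint_le_one _ _
        · simp
    have hgrid : ∑ m ∈ grid, Real.exp (∑ s, -(m s : ℝ) ^ 2 / 16) ≤ 33 ^ Fintype.card S := by
      simp_rw [Real.exp_sum]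
      rw [← Finset.prod_univ_sum (fun _ : S => Finset.Icc (-(M : ℤ)) M)
        (fun _ k => Real.exp (-(k : ℝ) ^ 2 / 16)), Finset.prod_const, Finset.card_univ]
      exact pow_le_pow_left₀ (Finset.sum_nonneg fun _ _ => (Real.exp_pos _).le)
        (sum_exp_neg_sq_le M) _
    calc ∑ δ, (∏ j, ρ (δ j)) * Φ δ
        = ∑ f : S → A, ∑ U : S → Bool, ∑ m ∈ grid, Real.exp (∑ s, -(m s : ℝ) ^ 2 / 16) *
          ∑ δ : Fin M → T, (∏ j, ρ (δ j)) *
            Real.exp (gridExponent x y μ P δ (ind U) (gridWeight M μ f m)) := by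
          simp only [Φ, Finset.mul_sum]
          rw [Finset.sum_comm]
          refine Finset.sum_congr rfl fun f _ => ?_
          rw [Finset.sum_comm]
          refine Finset.sum_congr rfl fun U _ => ?_
          rw [Finset.sum_comm]
          exact Finset.sum_congr rfl fun m _ => Finset.sum_congr rfl fun δ _ => by ring
      _ ≤ ∑ f : S → A, ∑ U : S → Bool, ∑ m ∈ grid, Real.exp (∑ s, -(m s : ℝ) ^ 2 / 16) :=
          Finset.sum_le_sum fun f _ => Finset.sum_le_sum fun U _ => Finset.sum_le_sum fun m _ =>
            mul_le_of_le_one_right (Real.exp_pos _).le (hle f U m)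
      _ ≤ ∑ f : S → A, ∑ U : S → Bool, 33 ^ Fintype.card S :=
          Finset.sum_le_sum fun f _ => Finset.sum_le_sum fun U _ => hgrid
      -- Each state contributes |A| actions, 2 vertex values and grid mass 33.
      _ = (66 * Fintype.card A : ℝ) ^ Fintype.card S := by
          simp only [Finset.sum_const, Finset.card_univ, Fintype.card_fun, Fintype.card_bool,
            nsmul_eq_mul, Nat.cast_pow, Nat.cast_ofNat]
          rw [← mul_pow, ← mul_pow]
          norm_num [mul_comm]
  · obtain ⟨U, hU⟩ := exists_vertex_ge (convexOn_sum_mul_kernelDeviation_sq x y δ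
      (fun s => M * μ (s, f s)) (fun s => mul_nonneg M.cast_nonneg (hμ0 _)) (fun s => (s, f s)) P) hG
    obtain ⟨m, hm, hle⟩ := exists_gridExponent_ge x y μ P hμ0
      (fun z => hμ1 ▸ Finset.single_le_sum (fun z _ => hμ0 z) (Finset.mem_univ z)) hP0 hP1 δ f
      (hind U)
    calc _ ≤ Real.exp (∑ s, -(m s : ℝ) ^ 2 / 16 +
          gridExponent x y μ P δ (ind U) (gridWeight M μ f m)) := by
          apply Real.exp_le_exp.2
          simp only [ind] at hle
          linarith
      _ ≤ Φ δ := by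
          rw [Real.exp_add]
          refine le_trans ?_ (Finset.single_le_sum (fun f _ => Finset.sum_nonneg fun U _ =>
            Finset.sum_nonneg fun m _ => hpos δ f U m) (Finset.mem_univ f))
          refine le_trans ?_ (Finset.single_le_sum (fun U _ =>
            Finset.sum_nonneg fun m _ => hpos δ f U m) (Finset.mem_univ U))
          exact Finset.single_le_sum (fun m _ => hpos δ f U m) (Fintype.mem_piFinset.2 hm)

end Moments

/-! ### Coverage by Rényi exploration and change of measure. -/

section Renyi

open Filter Topology

/-- First-order optimality for `w ↦ ∑ w ^ α` in the direction of `q`. -/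
theorem sum_mul_rpow_sub_one_le {ι : Type*} [Fintype ι] {α : ℝ} (hα0 : 0 < α) (hα1 : α < 1)
    {w q : ι → ℝ} (hw : ∀ i, 0 ≤ w i) (hq : ∀ i, 0 ≤ q i)
    (hmax : ∀ t : ℝ, 0 < t → t < 1 → ∑ i, ((1 - t) * w i + t * q i) ^ α ≤ ∑ i, w i ^ α) :
    (∀ i, w i = 0 → q i = 0) ∧ ∑ i, q i * w i ^ (α - 1) ≤ ∑ i, w i ^ α := by
  classical
  have h01 : Set.Ioo (0 : ℝ) 1 ∈ 𝓝[>] (0 : ℝ) := Ioo_mem_nhdsGT one_pos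
  -- Otherwise moving mass t toward q would gain (t q)^α at this coordinate and lose at most t ∑ w^α
  -- elsewhere, which is impossible as t → 0.
  have hsupp : ∀ i, w i = 0 → q i = 0 := by
    intro i₀ hi₀
    by_contra hne
    have hq0 : 0 < q i₀ := lt_of_le_of_ne (hq i₀) (Ne.symm hne)
    have hbound : ∀ t ∈ Set.Ioo (0 : ℝ) 1, q i₀ ^ α ≤ t ^ (1 - α) * ∑ i, w i ^ α := by
      rintro t ⟨ht0, ht1⟩
      have h1 : ∑ i, ((1 - t) * w i ^ α + if i = i₀ then (t * q i₀) ^ α else 0) ≤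
          ∑ i, ((1 - t) * w i + t * q i) ^ α := by
        refine Finset.sum_le_sum fun i _ => ?_
        by_cases hi : i = i₀
        · subst hi
          simp [hi₀, Real.zero_rpow hα0.ne']
        · rw [if_neg hi, add_zero]
          calc (1 - t) * w i ^ α ≤ (1 - t) ^ α * w i ^ α := by
                refine mul_le_mul_of_nonneg_right ?_ (Real.rpow_nonneg (hw i) _)
                have := Real.rpow_le_rpow_of_exponent_ge (sub_pos.2 ht1) (by linarith) hα1.le
                rwa [Real.rpow_one] at this
            _ = ((1 - t) * w i) ^ α := (Real.mul_rpow (by linarith) (hw i)).symm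
            _ ≤ _ := Real.rpow_le_rpow (mul_nonneg (by linarith) (hw i))
                (by linarith [mul_nonneg ht0.le (hq i)]) hα0.le
      have h2 := h1.trans (hmax t ht0 ht1)
      rw [Finset.sum_add_distrib, ← Finset.mul_sum, Finset.sum_ite_eq' Finset.univ i₀,
        if_pos (Finset.mem_univ _), Real.mul_rpow ht0.le hq0.le] at h2
      have h3 : t = t ^ α * t ^ (1 - α) := by
        rw [← Real.rpow_add ht0]; simp
      have h4 : t ^ α * q i₀ ^ α ≤ t ^ α * (t ^ (1 - α) * ∑ i, w i ^ α) := by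
        rw [← mul_assoc, ← h3]; linarith
      exact le_of_mul_le_mul_left h4 (Real.rpow_pos_of_pos ht0 _)
    have hlim : Tendsto (fun t : ℝ => t ^ (1 - α) * ∑ i, w i ^ α) (𝓝[>] 0) (𝓝 0) := by
      have hc : ContinuousAt (fun t : ℝ => t ^ (1 - α) * ∑ i, w i ^ α) 0 :=
        (Real.continuousAt_rpow_const 0 (1 - α) (Or.inr (by linarith))).mul continuousAt_const
      have := hc.tendsto
      rw [Real.zero_rpow (by linarith), zero_mul] at this
      exact this.mono_left nhdsWithin_le_nhds
    have := ge_of_tendsto hlim (Filter.mem_of_superset h01 hbound)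
    exact absurd (Real.rpow_pos_of_pos hq0 α) (not_lt.2 this)
  refine ⟨hsupp, ?_⟩
  -- Coordinates with w = 0 are constant by `hsupp`, so the singularity of the power at zero does no
  -- harm.
  have hderiv : HasDerivAt (fun t : ℝ => ∑ i, ((1 - t) * w i + t * q i) ^ α)
      (∑ i, α * (q i - w i) * w i ^ (α - 1)) 0 := by
    refine HasDerivAt.fun_sum fun i _ => ?_
    by_cases hi : w i = 0
    · simpa [hi, hsupp i hi] using hasDerivAt_const (0 : ℝ) ((0 : ℝ) ^ α)
    · have h1 : HasDerivAt (fun t : ℝ => (1 - t) * w i + t * q i) (q i - w i) 0 := by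
        have := (((hasDerivAt_id (0 : ℝ)).const_sub 1).mul_const (w i)).add
          ((hasDerivAt_id (0 : ℝ)).mul_const (q i))
        have e : q i - w i = -1 * w i + 1 * q i := by ring
        rw [e]
        exact this
      have h2 := h1.rpow_const (p := α) (Or.inl (by simpa using hi))
      have e : α * (q i - w i) * w i ^ (α - 1) =
          (q i - w i) * α * ((1 - 0) * w i + 0 * q i) ^ (α - 1) := by
        rw [sub_zero, one_mul, zero_mul, add_zero, mul_comm α]
      rw [e]
      exact h2
  have hle : ∑ i, α * (q i - w i) * w i ^ (α - 1) ≤ 0 := by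
    refine le_of_tendsto hderiv.tendsto_slope_zero_right (Filter.mem_of_superset h01 ?_)
    rintro t ⟨ht0, ht1⟩
    have := hmax t ht0 ht1
    simp only [Set.mem_ofPred_eq, zero_add, sub_zero, one_mul, zero_mul, add_zero, smul_eq_mul]
    exact mul_nonpos_of_nonneg_of_nonpos (inv_nonneg.2 ht0.le) (by linarith)
  have hww : ∀ i, w i * w i ^ (α - 1) = w i ^ α := fun i => by
    rcases (hw i).eq_or_lt with h | h
    · rw [← h, zero_mul, Real.zero_rpow hα0.ne']
    · rw [Real.rpow_sub_one h.ne']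
      field_simp
  have : ∑ i, α * (q i - w i) * w i ^ (α - 1) =
      α * (∑ i, q i * w i ^ (α - 1) - ∑ i, w i ^ α) := by
    rw [← Finset.sum_sub_distrib, Finset.mul_sum]
    exact Finset.sum_congr rfl fun i _ => by rw [← hww i]; ring
  rw [this] at hle
  have := nonpos_of_mul_nonpos_right hle hα0
  linarith

/-- Change of measure from `q` to `w` by Hölder's inequality. -/
theorem sum_mul_abs_le_rpow_mul_rpow {ι : Type*} [Fintype ι] {α : ℝ} (hα0 : 0 < α) (hα1 : α < 1)
    {w q X : ι → ℝ} (hw : ∀ i, 0 ≤ w i) (hq : ∀ i, 0 ≤ q i) (hq1 : ∀ i, q i ≤ 1)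
    (hwq : ∀ i, w i = 0 → q i = 0) (hX : ∀ i, |X i| ≤ 1) :
    ∑ i, q i * |X i| ≤ (∑ i, w i * X i ^ 2) ^ ((1 - α) / (2 - α)) *
      (∑ i, q i * w i ^ (α - 1)) ^ (1 - (1 - α) / (2 - α)) := by
  set θ := (1 - α) / (2 - α) with hθ
  have h2 : 0 < 2 - α := by linarith
  have hθ0 : 0 < θ := div_pos (by linarith) h2
  have hθ1 : 2 * θ ≤ 1 := by rw [hθ, mul_div_assoc', div_le_one h2]; linarith
  -- This identity determines θ: the powers of w cancel in the Hölder product.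
  have hθα : θ + (α - 1) * (1 - θ) = 0 := by rw [hθ]; field_simp; ring
  have hpq : (θ⁻¹).HolderConjugate (1 - θ)⁻¹ := by
    rw [Real.holderConjugate_iff]
    refine ⟨(one_lt_inv₀ hθ0).2 (by linarith), by rw [inv_inv, inv_inv]; ring⟩
  have ha : ∀ i, 0 ≤ w i * X i ^ 2 := fun i => mul_nonneg (hw i) (sq_nonneg _)
  have hb : ∀ i, 0 ≤ q i * w i ^ (α - 1) := fun i => mul_nonneg (hq i) (Real.rpow_nonneg (hw i) _)
  have hpt : ∀ i, q i * |X i| ≤ (w i * X i ^ 2) ^ θ * (q i * w i ^ (α - 1)) ^ (1 - θ) := by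
    intro i
    rcases (hq i).eq_or_lt with h | hqi
    · rw [← h, zero_mul]
      exact mul_nonneg (Real.rpow_nonneg (ha i) _) (Real.rpow_nonneg (by simp) _)
    have hwi : 0 < w i := lt_of_le_of_ne (hw i) fun h => hqi.ne' (hwq i h.symm)
    have e1 : (w i * X i ^ 2) ^ θ * (q i * w i ^ (α - 1)) ^ (1 - θ) =
        q i ^ (1 - θ) * (X i ^ 2) ^ θ := by
      rw [Real.mul_rpow hwi.le (sq_nonneg _), Real.mul_rpow hqi.le (Real.rpow_nonneg hwi.le _),
        ← Real.rpow_mul hwi.le]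
      have : w i ^ θ * w i ^ ((α - 1) * (1 - θ)) = 1 := by
        rw [← Real.rpow_add hwi, hθα, Real.rpow_zero]
      linear_combination (X i ^ 2) ^ θ * q i ^ (1 - θ) * this
    rw [e1]
    -- The bounds q ≤ 1 and |X| ≤ 1 absorb the remaining mismatch of exponents, the latter because
    -- 2θ ≤ 1.
    have e2 : q i ≤ q i ^ (1 - θ) := by
      have := Real.rpow_le_rpow_of_exponent_ge hqi (hq1 i) (show 1 - θ ≤ 1 by linarith)
      rwa [Real.rpow_one] at this
    have e3 : |X i| ≤ (X i ^ 2) ^ θ := by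
      rcases (abs_nonneg (X i)).eq_or_lt with h | h
      · rw [← h]; exact Real.rpow_nonneg (sq_nonneg _) _
      · rw [← sq_abs, ← Real.rpow_natCast_mul h.le]
        have := Real.rpow_le_rpow_of_exponent_ge h (hX i) hθ1
        rw [Real.rpow_one] at this
        exact_mod_cast this
    exact mul_le_mul e2 e3 (abs_nonneg _) (Real.rpow_nonneg hqi.le _)
  refine (Finset.sum_le_sum fun i _ => hpt i).trans ?_
  have := Real.inner_le_Lp_mul_Lq_of_nonneg Finset.univ hpq
    (fun i _ => Real.rpow_nonneg (ha i) θ) (fun i _ => Real.rpow_nonneg (hb i) (1 - θ))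
  simp only [one_div, inv_inv] at this
  refine this.trans_eq ?_
  congr 2
  · exact Finset.sum_congr rfl fun i _ => Real.rpow_rpow_inv (ha i) hθ0.ne'
  · exact Finset.sum_congr rfl fun i _ => Real.rpow_rpow_inv (hb i) (by linarith)

variable {S A B : Type*} [Fintype S] [Fintype A] [Fintype B]

theorem occupancy_le_one {n : ℕ} (G : MarkovGame S A B) (ν : S → stdSimplex ℝ B)
    (π : Policy S A (n + 1)) (h : Fin (n + 1)) (x : S × A) : occupancy G ν π h x ≤ 1 :=
  sum_occupancy G ν π h ▸ Finset.single_le_sum (fun x _ => occupancy_nonneg G ν π h x)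
    (Finset.mem_univ x)

theorem sum_rpow_pos_of_sum_eq_one {ι : Type*} [Fintype ι] {α : ℝ} {w : ι → ℝ}
    (hw : ∀ i, 0 ≤ w i) (hw1 : ∑ i, w i = 1) : 0 < ∑ i, w i ^ α := by
  obtain ⟨i, -, hi⟩ := Finset.exists_ne_zero_of_sum_ne_zero (hw1.trans_ne one_ne_zero)
  exact Finset.sum_pos' (fun i _ => Real.rpow_nonneg (hw i) _)
    ⟨i, Finset.mem_univ i, Real.rpow_pos_of_pos (lt_of_le_of_ne (hw i) hi.symm) _⟩

/-- Rényi exploration covers the occupancy of every policy. -/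
theorem IsRenyiExploration.coverage {n : ℕ} {G : MarkovGame S A B} {ν : S → stdSimplex ℝ B}
    {α : ℝ} (hα0 : 0 < α) (hα1 : α < 1) {ω : Fin (n + 1) → Policy S A (n + 1)}
    (hω : IsRenyiExploration G ν α ω) (h : Fin (n + 1)) (π : Policy S A (n + 1)) :
    (∀ x, occupancy G ν (ω h) h x = 0 → occupancy G ν π h x = 0) ∧
      ∑ x, occupancy G ν π h x * occupancy G ν (ω h) h x ^ (α - 1) ≤
        Fintype.card S * Fintype.card A := by
  have key := sum_mul_rpow_sub_one_le hα0 hα1 (occupancy_nonneg G ν (ω h) h)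
    (occupancy_nonneg G ν π h) fun t ht0 ht1 => by
      -- Mixtures are occupancies of actual policies. As 1/(1-α) > 0 and log is monotone, maximal
      -- entropy means maximal ∑ w^α.
      obtain ⟨σ, hσ⟩ := exists_policy_occupancy_mix G ν (ω h) π ht0.le ht1.le
      have h1 := le_of_mul_le_mul_left (hω h σ) (one_div_pos.2 (sub_pos.2 hα1))
      rw [Real.log_le_log_iff (sum_rpow_pos_of_sum_eq_one (occupancy_nonneg G ν σ h)
        (sum_occupancy G ν σ h)) (sum_rpow_pos_of_sum_eq_one (occupancy_nonneg G ν (ω h) h)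
        (sum_occupancy G ν (ω h) h))] at h1
      simp_rw [← hσ]
      exact h1
  refine ⟨key.1, key.2.trans ?_⟩
  calc ∑ x, occupancy G ν (ω h) h x ^ α ≤ ∑ _x : S × A, (1 : ℝ) :=
        Finset.sum_le_sum fun x _ =>
          Real.rpow_le_one (occupancy_nonneg _ _ _ _ _) (occupancy_le_one _ _ _ _ _) hα0.le
    _ = _ := by simp

end Renyi

/-! ### Backward induction and Bellman residuals. -/

section Planning

variable {S A B : Type*} [Fintype S] [Fintype B]

/-- `f` is greedy and `V` is the optimal value function for the transition kernels `k` and the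
reward `r`. -/
structure IsBellmanOptimal {n : ℕ} (k : Fin n → S × A → S → ℝ) (r : S → A → ℝ)
    (f : Fin (n + 1) → S → A) (V : Fin (n + 1) → S → ℝ) : Prop where
  le_last : ∀ s a, r s a ≤ V (Fin.last n) s
  eq_last : ∀ s, r s (f (Fin.last n) s) = V (Fin.last n) s
  le_castSucc : ∀ i s a, r s a + ∑ s', k i (s, a) s' * V i.succ s' ≤ V i.castSucc s
  eq_castSucc : ∀ i s, r s (f i.castSucc s) +
    ∑ s', k i (s, f i.castSucc s) s' * V i.succ s' = V i.castSucc s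

theorem exists_isBellmanOptimal [Finite A] [Nonempty A] {n : ℕ} (k : Fin n → S × A → S → ℝ)
    (r : S → A → ℝ) : ∃ f V, IsBellmanOptimal k r f V := by
  have hex : ∀ Q : S → A → ℝ, ∃ g : S → A, ∀ s a, Q s a ≤ Q s (g s) := fun Q => by
    choose g hg using fun s => Finite.exists_max (Q s)
    exact ⟨g, hg⟩
  choose g hg using hex
  let Q : Fin n → (S → ℝ) → S → A → ℝ := fun i v s a => r s a + ∑ s', k i (s, a) s' * v s'
  let V : Fin (n + 1) → S → ℝ := fun h => Fin.reverseInduction (motive := fun _ => S → ℝ)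
    (fun s => r s (g r s)) (fun i v s => Q i v s (g (Q i v) s)) h
  have hVl : V (Fin.last n) = fun s => r s (g r s) := Fin.reverseInduction_last ..
  have hVc : ∀ i : Fin n, V i.castSucc = fun s => Q i (V i.succ) s (g (Q i (V i.succ)) s) :=
    fun i => Fin.reverseInduction_castSucc ..
  let f : Fin (n + 1) → S → A := Fin.lastCases (g r) fun i => g (Q i (V i.succ))
  have hfl : f (Fin.last n) = g r := Fin.lastCases_last ..
  have hfc : ∀ i : Fin n, f i.castSucc = g (Q i (V i.succ)) := fun i => Fin.lastCases_castSucc ..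
  refine ⟨f, V, ⟨fun s a => ?_, fun s => ?_, fun i s a => ?_, fun i s => ?_⟩⟩
  · rw [hVl]; exact hg r s a
  · rw [hVl, hfl]
  · rw [hVc]; exact hg (Q i (V i.succ)) s a
  · rw [hVc, hfc]

/-- The value at a step is at most R times the number of remaining steps. Substochastic kernels
suffice, so the zero rows of the empirical kernel at unvisited points are allowed. -/
theorem IsBellmanOptimal.mem_Icc {n : ℕ} {k : Fin n → S × A → S → ℝ} {r : S → A → ℝ}
    {f : Fin (n + 1) → S → A} {V : Fin (n + 1) → S → ℝ} (hV : IsBellmanOptimal k r f V)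
    (hk0 : ∀ i x s, 0 ≤ k i x s) (hk1 : ∀ i x, ∑ s, k i x s ≤ 1) {R : ℝ}
    (hr : ∀ s a, r s a ∈ Set.Icc 0 R) (h : Fin (n + 1)) (s : S) :
    V h s ∈ Set.Icc 0 ((n + 1 : ℕ) * R) := by
  have hR : 0 ≤ R := (hr s (f h s)).1.trans (hr s (f h s)).2
  have key : ∀ (h : Fin (n + 1)) (s : S), 0 ≤ V h s ∧ V h s ≤ ((n : ℝ) + 1 - (h : ℕ)) * R := by
    intro h
    induction h using Fin.reverseInduction with
    | last =>
      intro s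
      rw [← hV.eq_last]
      have := hr s (f (Fin.last n) s)
      refine ⟨this.1, ?_⟩
      simp only [Fin.val_last]
      linarith [this.2]
    | cast i ih =>
      intro s
      rw [← hV.eq_castSucc]
      have h1 := hr s (f i.castSucc s)
      refine ⟨add_nonneg h1.1 (Finset.sum_nonneg fun s' _ =>
        mul_nonneg (hk0 _ _ _) (ih s').1), ?_⟩
      have hc : (0 : ℝ) ≤ (n : ℝ) + 1 - (i.succ : ℕ) := by
        have : ((i.succ : ℕ) : ℝ) ≤ n + 1 := by exact_mod_cast i.succ.2.le
        linarith
      have h2 : ∑ s', k i (s, f i.castSucc s) s' * V i.succ s' ≤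
          ((n : ℝ) + 1 - (i.succ : ℕ)) * R := by
        calc _ ≤ ∑ s', k i (s, f i.castSucc s) s' * (((n : ℝ) + 1 - (i.succ : ℕ)) * R) :=
              Finset.sum_le_sum fun s' _ => mul_le_mul_of_nonneg_left (ih s').2 (hk0 _ _ _)
          _ ≤ _ := by
              rw [← Finset.sum_mul]
              exact mul_le_of_le_one_left (mul_nonneg hc hR) (hk1 _ _)
      simp only [Fin.val_succ, Fin.val_castSucc] at h2 ⊢
      push_cast at h2
      linarith [h1.2]
  refine ⟨(key h s).1, (key h s).2.trans ?_⟩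
  push_cast
  exact mul_le_mul_of_nonneg_right (by linarith [(Nat.cast_nonneg h.1 : (0 : ℝ) ≤ (h.1 : ℝ))]) hR

variable [Fintype A]

/-- The performance of a policy in terms of the Bellman residuals of a value function. -/
theorem sum_init_sub_expectedReturn {n : ℕ} (G : MarkovGame S A B) (ν : S → stdSimplex ℝ B)
    (r : S → A → ℝ) (V : Fin (n + 1) → S → ℝ) (π : Policy S A (n + 1)) :
    ∑ s, G.init.1 s * V 0 s - expectedReturn G ν r π =
      ∑ x, occupancy G ν π (Fin.last n) x * (V (Fin.last n) x.1 - r x.1 x.2) +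
      ∑ i : Fin n, ∑ x, occupancy G ν π i.castSucc x *
        (V i.castSucc x.1 - r x.1 x.2 - ∑ s, attackerTrans G ν x.1 x.2 s * V i.succ s) := by
  let a : Fin (n + 1) → ℝ := fun h => ∑ x, occupancy G ν π h x * V h x.1
  have h0 : a 0 = ∑ s, G.init.1 s * V 0 s := by
    simp only [a, occupancy_zero, Fintype.sum_prod_type]
    refine Finset.sum_congr rfl fun s _ => ?_
    rw [← Finset.sum_mul, ← Finset.mul_sum, (π 0 s).2.2, mul_one]
  have hs : ∀ i : Fin n, a i.succ = ∑ x, occupancy G ν π i.castSucc x *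
      ∑ s, attackerTrans G ν x.1 x.2 s * V i.succ s := fun i => by
    rw [← trajExp_transition G ν π i (fun _ s => V i.succ s)]
    exact (trajExp_eq_sum_occupancy G ν π i.succ (fun x => V i.succ x.1)).symm
  -- Splitting off the first or the last of the same n + 1 terms is the telescoping.
  have htel : a 0 + ∑ i : Fin n, a i.succ = ∑ i : Fin n, a i.castSucc + a (Fin.last n) := by
    rw [← Fin.sum_univ_succ, ← Fin.sum_univ_castSucc]
  rw [expectedReturn_eq_sum_occupancy, Fin.sum_univ_castSucc, ← h0]
  simp only [mul_sub, Finset.sum_sub_distrib, ← hs]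
  linarith

/-- The deterministic policy with the given actions. -/
def deterministicPolicy {H : ℕ} (f : Fin H → S → A) : Policy S A H := by
  classical
  exact fun h s => ⟨Pi.single (f h s) 1, single_mem_stdSimplex ℝ (f h s)⟩

theorem occupancy_deterministicPolicy_of_ne {n : ℕ} (G : MarkovGame S A B)
    (ν : S → stdSimplex ℝ B) (f : Fin (n + 1) → S → A) (h : Fin (n + 1)) {s : S} {a : A}
    (ha : a ≠ f h s) : occupancy G ν (deterministicPolicy f) h (s, a) = 0 := by
  have h0 : (deterministicPolicy f h s).1 a = 0 := by
    classical
    simp only [deterministicPolicy]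
    exact Pi.single_eq_of_ne ha _
  induction h using Fin.cases with
  | zero => rw [occupancy_zero, h0, mul_zero]
  | succ i => rw [occupancy_succ, h0, mul_zero]

theorem sum_occupancy_deterministicPolicy_mul {n : ℕ} (G : MarkovGame S A B)
    (ν : S → stdSimplex ℝ B) (f : Fin (n + 1) → S → A) (h : Fin (n + 1)) (F : S × A → ℝ) :
    ∑ x, occupancy G ν (deterministicPolicy f) h x * F x =
      ∑ s, occupancy G ν (deterministicPolicy f) h (s, f h s) * F (s, f h s) := by
  rw [Fintype.sum_prod_type]
  exact Finset.sum_congr rfl fun s _ => Fintype.sum_eq_single (f h s) fun a ha => by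
    rw [occupancy_deterministicPolicy_of_ne G ν f h ha, zero_mul]

variable {n : ℕ} {k : Fin n → S × A → S → ℝ} {r : S → A → ℝ}
  {f : Fin (n + 1) → S → A} {V : Fin (n + 1) → S → ℝ}

/-- By the Bellman inequality for `k`, each residual in the true model is at least the kernel
difference applied to `V`. -/
theorem IsBellmanOptimal.le_sum_init_sub (hV : IsBellmanOptimal k r f V)
    (G : MarkovGame S A B) (ν : S → stdSimplex ℝ B) (π : Policy S A (n + 1)) :
    ∑ i : Fin n, ∑ x, occupancy G ν π i.castSucc x *
        (∑ s, k i x s * V i.succ s - ∑ s, attackerTrans G ν x.1 x.2 s * V i.succ s) ≤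
      ∑ s, G.init.1 s * V 0 s - expectedReturn G ν r π := by
  rw [sum_init_sub_expectedReturn]
  refine le_add_of_nonneg_of_le (Finset.sum_nonneg fun x _ =>
    mul_nonneg (occupancy_nonneg _ _ _ _ _) (sub_nonneg.2 (hV.le_last _ _))) ?_
  refine Finset.sum_le_sum fun i _ => Finset.sum_le_sum fun x _ =>
    mul_le_mul_of_nonneg_left ?_ (occupancy_nonneg _ _ _ _ _)
  linarith [hV.le_castSucc i x.1 x.2]

/-- Only greedy actions have positive occupancy, and for them the Bellman inequality is an equality.
-/
theorem IsBellmanOptimal.sum_init_sub_eq (hV : IsBellmanOptimal k r f V)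
    (G : MarkovGame S A B) (ν : S → stdSimplex ℝ B) :
    ∑ s, G.init.1 s * V 0 s - expectedReturn G ν r (deterministicPolicy f) =
      ∑ i : Fin n, ∑ x, occupancy G ν (deterministicPolicy f) i.castSucc x *
        (∑ s, k i x s * V i.succ s - ∑ s, attackerTrans G ν x.1 x.2 s * V i.succ s) := by
  rw [sum_init_sub_expectedReturn, sum_occupancy_deterministicPolicy_mul]
  have h0 : ∑ s, occupancy G ν (deterministicPolicy f) (Fin.last n) (s, f (Fin.last n) s) *
      (V (Fin.last n) s - r s (f (Fin.last n) s)) = 0 :=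
    Finset.sum_eq_zero fun s _ => by rw [hV.eq_last, sub_self, mul_zero]
  rw [h0, zero_add]
  refine Finset.sum_congr rfl fun i _ => ?_
  rw [sum_occupancy_deterministicPolicy_mul, sum_occupancy_deterministicPolicy_mul]
  refine Finset.sum_congr rfl fun s _ => ?_
  dsimp only
  rw [← hV.eq_castSucc i s]
  ring

/-- Some deterministic policy is optimal. -/
theorem exists_deterministicPolicy_optimal [Nonempty A] (G : MarkovGame S A B)
    (ν : S → stdSimplex ℝ B) (n : ℕ) (r : S → A → ℝ) :
    ∃ f : Fin (n + 1) → S → A, ∀ π : Policy S A (n + 1),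
      expectedReturn G ν r π ≤ expectedReturn G ν r (deterministicPolicy f) := by
  obtain ⟨f, V, hV⟩ := exists_isBellmanOptimal
    (fun (_ : Fin n) x s => attackerTrans G ν x.1 x.2 s) r
  refine ⟨f, fun π => ?_⟩
  have h1 := hV.le_sum_init_sub G ν π
  have h2 := hV.sum_init_sub_eq G ν
  simp only [sub_self, mul_zero, Finset.sum_const_zero] at h1 h2
  linarith

theorem expectedReturn_mem_Icc {R : ℝ} (G : MarkovGame S A B) (ν : S → stdSimplex ℝ B)
    (hr : ∀ s a, r s a ∈ Set.Icc 0 R) (π : Policy S A (n + 1)) :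
    expectedReturn G ν r π ∈ Set.Icc 0 ((n + 1 : ℕ) * R) := by
  rw [expectedReturn_eq_sum_occupancy]
  refine ⟨Finset.sum_nonneg fun h _ => Finset.sum_nonneg fun x _ =>
    mul_nonneg (occupancy_nonneg _ _ _ _ _) (hr _ _).1, ?_⟩
  calc _ ≤ ∑ h : Fin (n + 1), ∑ x, occupancy G ν π h x * R :=
        Finset.sum_le_sum fun h _ => Finset.sum_le_sum fun x _ =>
          mul_le_mul_of_nonneg_left (hr _ _).2 (occupancy_nonneg _ _ _ _ _)
    _ = _ := by simp [← Finset.sum_mul, sum_occupancy]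

end Planning

/-! ### Nonnegativity of the empirical entropy. -/

section Entropy

theorem EntropyKind.entropy_nonneg {ι : Type*} [Fintype ι] (κ : EntropyKind) {d : ι → ℝ}
    (hd : ∀ i, d i ∈ Set.Icc (0 : ℝ) 1) (hs : ∑ i, d i = 0 ∨ ∑ i, d i = 1) : 0 ≤ κ.entropy d := by
  cases κ with
  | shannon =>
    simp only [EntropyKind.entropy, shannonEntropy, neg_nonneg]
    exact Finset.sum_nonpos fun i _ =>
      mul_nonpos_of_nonneg_of_nonpos (hd i).1 (Real.log_nonpos (hd i).1 (hd i).2)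
  | renyiHalf =>
    simp only [EntropyKind.entropy, renyiEntropy]
    refine mul_nonneg (by norm_num) ?_
    rcases hs with hs | hs
    -- An unobserved state gives the zero vector; `Real.log 0 = 0` makes its entropy 0.
    · have := (Finset.sum_eq_zero_iff_of_nonneg fun i _ => (hd i).1).1 hs
      rw [Finset.sum_eq_zero fun i hi => by rw [this i hi]; norm_num, Real.log_zero]
    · have : ∑ i, d i ≤ ∑ i, d i ^ (1 / 2 : ℝ) := Finset.sum_le_sum fun i _ =>
        Real.self_le_rpow_of_le_one (hd i).1 (hd i).2 (by norm_num)
      exact Real.log_nonneg (hs ▸ this)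

theorem empiricalEntropy_nonneg {S B : Type*} [Fintype B] {K : ℕ} (κ : EntropyKind)
    (obs : Fin K → S × B) (s : S) : 0 ≤ empiricalEntropy κ obs s := by
  have h0 : ∀ b, (0 : ℝ) ≤ victimCount obs s b := fun b => Nat.cast_nonneg _
  refine κ.entropy_nonneg (fun b => ⟨div_nonneg (h0 b) (Finset.sum_nonneg fun b _ => h0 b),
    div_le_one_of_le₀ (Finset.single_le_sum (fun b _ => h0 b) (Finset.mem_univ b))
      (Finset.sum_nonneg fun b _ => h0 b)⟩) ?_
  simp only [empiricalPolicy, ← Finset.sum_div]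
  rcases eq_or_ne (∑ b, (victimCount obs s b : ℝ)) 0 with h | h
  · left; rw [h, div_zero]
  · right; exact div_self h

end Entropy

/-! ### Good datasets, sample size and regret. -/

section Guarantee

variable {S A B : Type*} [Fintype S] [Fintype A] [Fintype B]

/-- The transition kernels estimated from a dataset, separately for each step. -/
def estimatedKernel {n M : ℕ} (δ : Fin M → Trajectory S A (n + 1)) (i : Fin n) : S × A → S → ℝ :=
  empiricalKernel (fun τ : Trajectory S A (n + 1) => τ i.castSucc)
    (fun τ : Trajectory S A (n + 1) => (τ i.succ).1) δ

/-- The deviation of the estimated kernels from the true transition probabilities. -/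
def estimationError {n M : ℕ} (G : MarkovGame S A B) (ν : S → stdSimplex ℝ B)
    (δ : Fin M → Trajectory S A (n + 1)) (i : Fin n) (z : S × A) (g : S → ℝ) : ℝ :=
  kernelDeviation (fun τ : Trajectory S A (n + 1) => τ i.castSucc)
    (fun τ : Trajectory S A (n + 1) => (τ i.succ).1) δ z
    (fun z s => attackerTrans G ν z.1 z.2 s) g

theorem datasetProb_nonneg {H M : ℕ} (G : MarkovGame S A B) (ν : S → stdSimplex ℝ B)
    (ω : Fin H → Policy S A H) (δ : Fin M → Trajectory S A H) : 0 ≤ datasetProb G ν ω δ :=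
  Finset.prod_nonneg fun _ _ => mul_nonneg (by positivity)
    (Finset.sum_nonneg fun _ _ => trajProb_nonneg _ _ _ _)

theorem sum_datasetProb {n : ℕ} (M : ℕ) (G : MarkovGame S A B) (ν : S → stdSimplex ℝ B)
    (ω : Fin (n + 1) → Policy S A (n + 1)) :
    ∑ δ : Fin M → Trajectory S A (n + 1), datasetProb G ν ω δ = 1 := by
  unfold datasetProb
  rw [← Fintype.sum_pow (fun τ => 1 / ((n + 1 : ℕ) : ℝ) * ∑ h, trajProb G ν (ω h) τ),
    ← Finset.mul_sum, Finset.sum_comm]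
  simp only [sum_trajProb, Finset.sum_const, Finset.card_univ, Fintype.card_fin, nsmul_eq_mul,
    mul_one]
  rw [one_div_mul_cancel (by positivity), one_pow]

/-- A dataset functional with bounded expectation that controls the estimation error at step `i`
in the occupancy measure of the exploration policy of that step. -/
theorem exists_dataset_functional {n : ℕ} (M : ℕ) (G : MarkovGame S A B) (ν : S → stdSimplex ℝ B)
    (ω : Fin (n + 1) → Policy S A (n + 1)) (i : Fin n) :
    ∃ Φ : (Fin M → Trajectory S A (n + 1)) → ℝ, (∀ δ, 0 ≤ Φ δ) ∧
      ∑ δ, datasetProb G ν ω δ * Φ δ ≤ (66 * Fintype.card A : ℝ) ^ Fintype.card S ∧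
      ∀ δ (f : S → A) (g : S → ℝ), (∀ s, g s ∈ Set.Icc (0 : ℝ) 1) →
        Real.exp ((∑ s, M / (n + 1 : ℕ) * occupancy G ν (ω i.castSucc) i.castSucc (s, f s) *
          estimationError G ν δ i (s, f s) g ^ 2) / 32 - Fintype.card S / 16) ≤ Φ δ := by
  set H : ℝ := ((n + 1 : ℕ) : ℝ) with hH
  have hHpos : 0 < H := by positivity
  let ρ : Trajectory S A (n + 1) → ℝ := fun τ => 1 / H * ∑ h, trajProb G ν (ω h) τ
  let μ : S × A → ℝ := fun z => 1 / H * ∑ h, occupancy G ν (ω h) i.castSucc z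
  have hμ1 : ∑ z, μ z = 1 := by
    simp only [μ]
    rw [← Finset.mul_sum, Finset.sum_comm]
    simp only [sum_occupancy, Finset.sum_const, Finset.card_univ, Fintype.card_fin, nsmul_eq_mul,
      mul_one]
    exact one_div_mul_cancel hHpos.ne'
  have hρ : ∀ g : S × A → S → ℝ, ∑ τ, ρ τ * g (τ i.castSucc) (τ i.succ).1 =
      ∑ z, μ z * ∑ s, attackerTrans G ν z.1 z.2 s * g z s := fun g => by
    have h := fun h => trajExp_transition G ν (ω h) i g
    simp only [trajExp] at h
    simp only [ρ, μ, mul_assoc, ← Finset.mul_sum]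
    simp only [Finset.sum_mul]
    rw [Finset.sum_comm]
    simp only [h]
    rw [Finset.sum_comm]
  obtain ⟨Φ, h0, h1, h2⟩ := exists_moment_functional M ρ (fun τ => τ i.castSucc)
    (fun τ => (τ i.succ).1) μ (fun z s => attackerTrans G ν z.1 z.2 s)
    (fun τ => mul_nonneg (by positivity) (Finset.sum_nonneg fun h _ => trajProb_nonneg _ _ _ _))
    (fun z => mul_nonneg (by positivity) (Finset.sum_nonneg fun h _ => occupancy_nonneg _ _ _ _ _))
    hμ1 (fun z s => attackerTrans_nonneg _ _ _ _ _) (fun z => sum_attackerTrans _ _ _ _) hρ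
  refine ⟨Φ, h0, h1, fun δ f g hg => le_trans (Real.exp_le_exp.2 ?_) (h2 δ f g hg)⟩
  have : ∑ s, M / H * occupancy G ν (ω i.castSucc) i.castSucc (s, f s) *
        estimationError G ν δ i (s, f s) g ^ 2 ≤
      ∑ s, M * μ (s, f s) * estimationError G ν δ i (s, f s) g ^ 2 := by
    refine Finset.sum_le_sum fun s _ => mul_le_mul_of_nonneg_right ?_ (sq_nonneg _)
    -- The data come from the uniform mixture of the exploration policies, which dominates 1/H times
    -- the occupancy of the policy designed for this step.
    have h3 : occupancy G ν (ω i.castSucc) i.castSucc (s, f s) ≤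
        ∑ h, occupancy G ν (ω h) i.castSucc (s, f s) :=
      Finset.single_le_sum (f := fun h => occupancy G ν (ω h) i.castSucc (s, f s))
        (fun h _ => occupancy_nonneg _ _ _ _ _) (Finset.mem_univ _)
    calc _ ≤ M / H * ∑ h, occupancy G ν (ω h) i.castSucc (s, f s) :=
          mul_le_mul_of_nonneg_left h3 (by positivity)
      _ = _ := by simp only [μ]; ring
  exact sub_le_sub_right (div_le_div_of_nonneg_right this (by norm_num)) _

/-- The constant is 162 = 4 · 32 + 34: the fourth power comes from 66a/p ≤ (3a/p)⁴, and 32 + 2s ≤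
34s is absorbed because the logarithm is at least 1, as 3 > e. -/
theorem log_numeric_bound {s a p : ℝ} (hs : 1 ≤ s) (ha : 1 ≤ a) (hp0 : 0 < p) (hp1 : p < 1) :
    1 ≤ Real.log (3 * s * a / p) ∧
      32 * (s * Real.log (66 * a) - Real.log p) + 32 + 2 * s ≤
        162 * s * Real.log (3 * s * a / p) := by
  have hz : 1 ≤ a / p := (one_le_div hp0).2 (by linarith)
  have hsz : a / p ≤ s * (a / p) := le_mul_of_one_le_left (by linarith) hs
  have e : 3 * s * a / p = 3 * (s * (a / p)) := by ring
  have hL1 : 1 ≤ Real.log (3 * s * a / p) := by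
    rw [Real.le_log_iff_exp_le (by positivity), e]
    linarith [Real.exp_one_lt_d9]
  refine ⟨hL1, ?_⟩
  have h1 : Real.log (66 * a) - Real.log p ≤ 4 * Real.log (3 * s * a / p) := by
    rw [← Real.log_div (by positivity) hp0.ne', ← Nat.cast_ofNat (n := 4), ← Real.log_pow]
    refine Real.log_le_log (by positivity) ?_
    rw [e]
    calc 66 * a / p = 66 * (a / p) := by ring
      _ ≤ 81 * (a / p) ^ 4 := by nlinarith [pow_le_pow_right₀ hz (show 1 ≤ 4 by norm_num)]
      _ = (3 * (a / p)) ^ 4 := by ring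
      _ ≤ (3 * (s * (a / p))) ^ 4 := by gcongr
  have h2 : Real.log p ≤ 0 := Real.log_nonpos hp0.le hp1.le
  nlinarith [mul_le_mul_of_nonneg_left h1 (by linarith : (0 : ℝ) ≤ s),
    mul_nonneg (sub_nonneg.2 hs) (neg_nonneg.2 h2)]

/-- With probability at least `1 - p` the estimation error is small in the occupancy measures of
the exploration policies, uniformly over deterministic policies and bounded functions. -/
theorem exists_good_datasets [Nonempty S] [Nonempty A] {n : ℕ} (M : ℕ) (G : MarkovGame S A B)
    (ν : S → stdSimplex ℝ B) (ω : Fin (n + 1) → Policy S A (n + 1)) {p : ℝ} (hp0 : 0 < p)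
    (hp1 : p < 1) :
    ∃ good : Finset (Fin M → Trajectory S A (n + 1)),
      1 - p ≤ ∑ δ ∈ good, datasetProb G ν ω δ ∧
      ∀ δ ∈ good, ∀ (f : Fin n → S → A) (g : Fin n → S → ℝ),
        (∀ i s, g i s ∈ Set.Icc (0 : ℝ) 1) →
        ∑ i, ∑ s, M / (n + 1 : ℕ) * occupancy G ν (ω i.castSucc) i.castSucc (s, f i s) *
          estimationError G ν δ i (s, f i s) (g i) ^ 2 ≤
        (n + 1 : ℕ) * (162 * Fintype.card S *
          Real.log (3 * Fintype.card S * Fintype.card A / p)) := by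
  classical
  choose Φ hΦ0 hΦ1 hΦ2 using exists_dataset_functional M G ν ω
  have hs : (1 : ℝ) ≤ Fintype.card S := by exact_mod_cast Fintype.card_pos
  have ha : (1 : ℝ) ≤ Fintype.card A := by exact_mod_cast Fintype.card_pos
  set b : ℝ := (66 * Fintype.card A) ^ Fintype.card S with hb
  have hb1 : 1 ≤ b := one_le_pow₀ (by linarith)
  have hbp : 1 ≤ b / p := (one_le_div hp0).2 (by linarith)
  set H : ℝ := ((n + 1 : ℕ) : ℝ) with hH
  have hH1 : H = n + 1 := by simp [hH]
  have hn0 : (0 : ℝ) ≤ n := n.cast_nonneg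
  -- Markov's inequality is applied to the sum over steps. A union bound over steps would put an
  -- additional factor H inside the logarithm.
  let Ψ : (Fin M → Trajectory S A (n + 1)) → ℝ := fun δ => ∑ i, Φ i δ
  let good : Finset (Fin M → Trajectory S A (n + 1)) := Finset.univ.filter fun δ => Ψ δ ≤ H * (b / p)
  refine ⟨good, ?_, fun δ hδ f g hg => ?_⟩
  · have hΨ : ∑ δ, datasetProb G ν ω δ * Ψ δ ≤ H * b := by
      simp only [Ψ, Finset.mul_sum]
      rw [Finset.sum_comm]
      calc _ ≤ ∑ _i : Fin n, b := Finset.sum_le_sum fun i _ => hΦ1 i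
        _ = n * b := by simp
        _ ≤ H * b := by rw [hH1]; nlinarith
    have hsplit := Finset.sum_filter_add_sum_filter_not Finset.univ (fun δ => Ψ δ ≤ H * (b / p))
      (datasetProb G ν ω)
    rw [sum_datasetProb] at hsplit
    have hbad : (∑ δ with ¬ Ψ δ ≤ H * (b / p), datasetProb G ν ω δ) * (H * (b / p)) ≤ H * b := by
      rw [Finset.sum_mul]
      refine le_trans (Finset.sum_le_sum fun δ hδ => ?_) ((Finset.sum_le_sum_of_subset_of_nonneg
        (Finset.filter_subset _ _) fun δ _ _ => mul_nonneg (datasetProb_nonneg G ν ω δ)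
          (Finset.sum_nonneg fun i _ => hΦ0 i δ)).trans hΨ)
      exact mul_le_mul_of_nonneg_left (not_le.1 (Finset.mem_filter.1 hδ).2).le
        (datasetProb_nonneg _ _ _ _)
    have hHb : 0 < H * b := by rw [hH1]; positivity
    have hbad' : ∑ δ with ¬ Ψ δ ≤ H * (b / p), datasetProb G ν ω δ ≤ p := by
      have e : (∑ δ with ¬ Ψ δ ≤ H * (b / p), datasetProb G ν ω δ) * (H * (b / p)) =
        ((∑ δ with ¬ Ψ δ ≤ H * (b / p), datasetProb G ν ω δ) / p) * (H * b) := by ring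
      rw [e] at hbad
      have := le_of_mul_le_mul_right (hbad.trans_eq (one_mul _).symm) hHb
      rwa [div_le_one hp0] at this
    change 1 - p ≤ ∑ δ with Ψ δ ≤ H * (b / p), datasetProb G ν ω δ
    linarith
  · have hδ' : Ψ δ ≤ H * (b / p) := (Finset.mem_filter.1 hδ).2
    have h1 : ∀ i, ∑ s, M / H * occupancy G ν (ω i.castSucc) i.castSucc (s, f i s) *
        estimationError G ν δ i (s, f i s) (g i) ^ 2 ≤
        32 * (Real.log (b / p) + Φ i δ / (b / p) - 1) + 2 * Fintype.card S := fun i => by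
      have h2 := hΦ2 i δ (f i) (g i) (hg i)
      set W := ∑ s, M / H * occupancy G ν (ω i.castSucc) i.castSucc (s, f i s) *
        estimationError G ν δ i (s, f i s) (g i) ^ 2
      -- A tangent-line bound in place of taking logarithms: it is linear in `Φ i δ`, so summing
      -- over steps involves only `Ψ δ`.
      have h3 := Real.add_one_le_exp (W / 32 - Fintype.card S / 16 - Real.log (b / p))
      rw [Real.exp_sub, Real.exp_log (by linarith)] at h3
      have h4 : Real.exp (W / 32 - Fintype.card S / 16) / (b / p) ≤ Φ i δ / (b / p) :=
        div_le_div_of_nonneg_right h2 (by linarith)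
      linarith
    refine (Finset.sum_le_sum fun i _ => h1 i).trans ?_
    have h5 : ∑ i : Fin n, (32 * (Real.log (b / p) + Φ i δ / (b / p) - 1) +
        2 * (Fintype.card S : ℝ)) =
        32 * (n * Real.log (b / p) + Ψ δ / (b / p) - n) + n * (2 * Fintype.card S) := by
      simp only [Ψ, Finset.sum_add_distrib, Finset.sum_sub_distrib, ← Finset.mul_sum,
        Finset.sum_div, Finset.sum_const, Finset.card_univ, Fintype.card_fin, nsmul_eq_mul, mul_one]
      ring
    have h6 : Ψ δ / (b / p) ≤ H := (div_le_iff₀ (by linarith)).2 hδ'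
    have h7 := log_numeric_bound hs ha hp0 hp1
    have h8 : Real.log (b / p) = Fintype.card S * Real.log (66 * Fintype.card A) - Real.log p := by
      rw [Real.log_div (by positivity) hp0.ne', hb, Real.log_pow]
    rw [← h8] at h7
    have h9 : 0 ≤ Real.log (b / p) := Real.log_nonneg hbp
    rw [h5]
    calc 32 * (n * Real.log (b / p) + Ψ δ / (b / p) - n) + n * (2 * Fintype.card S)
        ≤ H * (32 * Real.log (b / p) + 32 + 2 * Fintype.card S) := by
          rw [hH1] at h6 ⊢; nlinarith
      _ ≤ _ := mul_le_mul_of_nonneg_left h7.2 (by rw [hH1]; positivity)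

/-- The change of measure from the exploration policies to a deterministic policy. -/
theorem sum_occupancy_mul_abs_estimationError_le {n M : ℕ} (hM : 0 < M) {G : MarkovGame S A B}
    {ν : S → stdSimplex ℝ B} {α : ℝ} (hα0 : 0 < α) (hα1 : α < 1)
    {ω : Fin (n + 1) → Policy S A (n + 1)} (hω : IsRenyiExploration G ν α ω)
    {δ : Fin M → Trajectory S A (n + 1)} (π : Policy S A (n + 1)) (f : Fin n → S → A)
    {g : Fin n → S → ℝ} (hg : ∀ i s, g i s ∈ Set.Icc (0 : ℝ) 1) {K : ℝ}
    (hK : ∑ i, ∑ s, M / (n + 1 : ℕ) * occupancy G ν (ω i.castSucc) i.castSucc (s, f i s) *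
          estimationError G ν δ i (s, f i s) (g i) ^ 2 ≤ (n + 1 : ℕ) * K) :
    ∑ i, ∑ s, occupancy G ν π i.castSucc (s, f i s) *
        |estimationError G ν δ i (s, f i s) (g i)| ≤
      ((n + 1 : ℕ) ^ 2 * K / M) ^ ((1 - α) / (2 - α)) *
        ((n + 1 : ℕ) * Fintype.card S * Fintype.card A) ^ (1 - (1 - α) / (2 - α)) := by
  set H : ℝ := ((n + 1 : ℕ) : ℝ) with hH
  have hH1 : H = n + 1 := by simp [hH]
  have hHpos : 0 < H := by rw [hH1]; positivity
  have hMpos : (0 : ℝ) < M := by exact_mod_cast hM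
  have h2 : 0 < 2 - α := by linarith
  have hθ0 : 0 ≤ (1 - α) / (2 - α) := div_nonneg (by linarith) h2.le
  have hθ1 : (1 - α) / (2 - α) ≤ 1 := by rw [div_le_one h2]; linarith
  -- One application of Hölder's inequality covers all steps and states together, at the actions
  -- selected by `f`.
  have key := sum_mul_abs_le_rpow_mul_rpow (ι := Fin n × S) hα0 hα1
    (w := fun x => occupancy G ν (ω x.1.castSucc) x.1.castSucc (x.2, f x.1 x.2))
    (q := fun x => occupancy G ν π x.1.castSucc (x.2, f x.1 x.2))
    (X := fun x => estimationError G ν δ x.1 (x.2, f x.1 x.2) (g x.1))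
    (fun x => occupancy_nonneg _ _ _ _ _) (fun x => occupancy_nonneg _ _ _ _ _)
    (fun x => occupancy_le_one _ _ _ _ _)
    (fun x => (hω.coverage hα0 hα1 x.1.castSucc π).1 _)
    (fun x => abs_kernelDeviation_le_one _ _ _ _ (fun s => attackerTrans_nonneg _ _ _ _ _)
      (sum_attackerTrans _ _ _ _) (hg _))
  simp only [Fintype.sum_prod_type] at key
  have hnn1 : 0 ≤ ∑ i : Fin n, ∑ s, occupancy G ν (ω i.castSucc) i.castSucc (s, f i s) *
      estimationError G ν δ i (s, f i s) (g i) ^ 2 :=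
    Finset.sum_nonneg fun i _ => Finset.sum_nonneg fun s _ =>
      mul_nonneg (occupancy_nonneg _ _ _ _ _) (sq_nonneg _)
  have hterm : ∀ i : Fin n, ∀ x : S × A, 0 ≤ occupancy G ν π i.castSucc x *
      occupancy G ν (ω i.castSucc) i.castSucc x ^ (α - 1) := fun i x =>
    mul_nonneg (occupancy_nonneg _ _ _ _ _) (Real.rpow_nonneg (occupancy_nonneg _ _ _ _ _) _)
  refine key.trans (mul_le_mul (Real.rpow_le_rpow hnn1 ?_ hθ0) (Real.rpow_le_rpow
    (Finset.sum_nonneg fun i _ => Finset.sum_nonneg fun s _ => hterm i _) ?_ (by linarith))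
    (Real.rpow_nonneg (Finset.sum_nonneg fun i _ => Finset.sum_nonneg fun s _ => hterm i _) _)
    (Real.rpow_nonneg (hnn1.trans ?_) _))
  rotate_left
  · calc _ ≤ ∑ _i : Fin n, (Fintype.card S * Fintype.card A : ℝ) := by
          refine Finset.sum_le_sum fun i _ =>
            le_trans ?_ (hω.coverage hα0 hα1 i.castSucc π).2
          rw [Fintype.sum_prod_type]
          exact Finset.sum_le_sum fun s _ => Finset.single_le_sum
            (f := fun a => occupancy G ν π i.castSucc (s, a) *
              occupancy G ν (ω i.castSucc) i.castSucc (s, a) ^ (α - 1))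
            (fun a _ => hterm i (s, a)) (Finset.mem_univ (f i s))
      _ = n * (Fintype.card S * Fintype.card A : ℝ) := by simp
      _ ≤ _ := by
          rw [hH1, mul_assoc]
          exact mul_le_mul_of_nonneg_right (by linarith) (by positivity)
  all_goals
    rw [le_div_iff₀ hMpos]
    have e : ∑ i : Fin n, ∑ s, M / H * occupancy G ν (ω i.castSucc) i.castSucc (s, f i s) *
        estimationError G ν δ i (s, f i s) (g i) ^ 2 =
        M / H * ∑ i : Fin n, ∑ s, occupancy G ν (ω i.castSucc) i.castSucc (s, f i s) *
          estimationError G ν δ i (s, f i s) (g i) ^ 2 := by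
      simp only [Finset.mul_sum, mul_assoc]
    rw [e, div_mul_eq_mul_div, div_le_iff₀ hHpos] at hK
    linarith

/-- The sample size makes the first base at most Hsa / Y^(1/θ). After the power θ the two factors
combine to Hsa/Y, and Y is chosen so that HR · Hsa/Y = ε. The 3 inside the logarithm is supplied by
3ε < HR. -/
theorem sample_size_bound {H s a ε R α β p M : ℝ} (hH : 1 ≤ H) (hs : 1 ≤ s) (ha : 1 ≤ a)
    (hε : 0 < ε) (hR : 0 < R) (hα0 : 0 < α) (hα1 : α < 1) (hβ : β = α / (2 * (1 - α)))
    (hp0 : 0 < p) (hp1 : p < 1) (hlarge : 3 * ε < H * R)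
    (hM : 162 * (H ^ 2 * s * a / (ε / R)) ^ (2 * (β + 1)) * (H / a) *
      Real.log (s * a * H / (p * (ε / R))) ≤ M) :
    0 < M ∧ H * R * ((H ^ 2 * (162 * s * Real.log (3 * s * a / p)) / M) ^ ((1 - α) / (2 - α)) *
      (H * s * a) ^ (1 - (1 - α) / (2 - α))) ≤ ε := by
  set θ := (1 - α) / (2 - α) with hθ
  have h2 : 0 < 2 - α := by linarith
  have h1 : 0 < 1 - α := by linarith
  have hθ0 : 0 < θ := div_pos h1 h2
  have hexp : 2 * (β + 1) = θ⁻¹ := by rw [hβ, hθ]; field_simp; ring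
  have hL := (log_numeric_bound hs ha hp0 hp1).1
  set L := Real.log (3 * s * a / p) with hLdef
  set Y := H ^ 2 * s * a / (ε / R) with hY
  have hYpos : 0 < Y := by positivity
  have hLL : L ≤ Real.log (s * a * H / (p * (ε / R))) := by
    refine Real.log_le_log (by positivity) ?_
    have e : s * a * H / (p * (ε / R)) = (H * R / ε) * (s * a / p) := by field_simp
    have e' : 3 * s * a / p = 3 * (s * a / p) := by ring
    rw [e, e']
    refine mul_le_mul_of_nonneg_right ?_ (by positivity)
    rw [le_div_iff₀ hε]
    exact hlarge.le
  rw [hexp] at hM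
  have hM' : 162 * Y ^ θ⁻¹ * (H / a) * L ≤ M :=
    (mul_le_mul_of_nonneg_left hLL (by positivity)).trans hM
  have hYθ : 0 < Y ^ θ⁻¹ := Real.rpow_pos_of_pos hYpos _
  have hMpos : 0 < M := lt_of_lt_of_le (by positivity) hM'
  refine ⟨hMpos, ?_⟩
  have h3 : H ^ 2 * (162 * s * L) / M ≤ H * s * a / Y ^ θ⁻¹ := by
    rw [div_le_div_iff₀ hMpos hYθ]
    calc H ^ 2 * (162 * s * L) * Y ^ θ⁻¹ = H * s * a * (162 * Y ^ θ⁻¹ * (H / a) * L) := by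
          field_simp
      _ ≤ _ := mul_le_mul_of_nonneg_left hM' (by positivity)
  have h4 : (H ^ 2 * (162 * s * L) / M) ^ θ ≤ (H * s * a) ^ θ / Y := by
    refine (Real.rpow_le_rpow (by positivity) h3 hθ0.le).trans_eq ?_
    rw [Real.div_rpow (by positivity) hYθ.le, Real.rpow_inv_rpow hYpos.le hθ0.ne']
  calc H * R * ((H ^ 2 * (162 * s * L) / M) ^ θ * (H * s * a) ^ (1 - θ))
      ≤ H * R * ((H * s * a) ^ θ / Y * (H * s * a) ^ (1 - θ)) := by gcongr
    _ = H * R * (((H * s * a) ^ θ * (H * s * a) ^ (1 - θ)) / Y) := by ring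
    _ = H * R * (H * s * a / Y) := by
        rw [← Real.rpow_add (by positivity)]; simp
    _ = ε := by rw [hY]; field_simp

/-- On a good dataset the greedy policy of the estimated model is nearly optimal. -/
theorem regret_le_of_estimationError_le {n M : ℕ} (G : MarkovGame S A B) (ν : S → stdSimplex ℝ B)
    (δ : Fin M → Trajectory S A (n + 1)) {r : S → A → ℝ} {R ε : ℝ} (hR : 0 < R)
    (hr : ∀ s a, r s a ∈ Set.Icc 0 R) {f f' : Fin (n + 1) → S → A} {V : Fin (n + 1) → S → ℝ}
    (hV : IsBellmanOptimal (estimatedKernel δ) r f V)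
    (herr : ∀ (f : Fin (n + 1) → S → A) (g : Fin n → S → ℝ),
      (∀ i s, g i s ∈ Set.Icc (0 : ℝ) 1) →
      (n + 1 : ℕ) * R * ∑ i : Fin n, ∑ s,
        occupancy G ν (deterministicPolicy f) i.castSucc (s, f i.castSucc s) *
          |estimationError G ν δ i (s, f i.castSucc s) (g i)| ≤ ε) :
    expectedReturn G ν r (deterministicPolicy f') -
      expectedReturn G ν r (deterministicPolicy f) ≤ 2 * ε := by
  set c : ℝ := (n + 1 : ℕ) * R with hc
  have hcpos : 0 < c := by positivity
  have hVb := hV.mem_Icc (fun i x s => empiricalKernel_nonneg _ _ _ _ _)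
    (fun i x => sum_empiricalKernel_le_one _ _ _ _) hr
  -- Normalized to [0, 1]; this function depends on the data, hence the need for a bound uniform in
  -- `g`.
  let g : Fin n → S → ℝ := fun i s => V i.succ s / c
  have hg : ∀ i s, g i s ∈ Set.Icc (0 : ℝ) 1 := fun i s =>
    ⟨div_nonneg (hVb _ _).1 hcpos.le, div_le_one_of_le₀ (hVb _ _).2 hcpos.le⟩
  have hdev : ∀ i x, ∑ s, estimatedKernel δ i x s * V i.succ s -
      ∑ s, attackerTrans G ν x.1 x.2 s * V i.succ s = c * estimationError G ν δ i x (g i) := by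
    intro i x
    have : ∀ s, V i.succ s = c * g i s := fun s => (mul_div_cancel₀ _ hcpos.ne').symm
    simp only [this, mul_left_comm _ c, ← Finset.mul_sum, ← mul_sub]
    rfl
  have habs : ∀ f : Fin (n + 1) → S → A, |∑ i : Fin n, ∑ x,
      occupancy G ν (deterministicPolicy f) i.castSucc x *
        (∑ s, estimatedKernel δ i x s * V i.succ s -
          ∑ s, attackerTrans G ν x.1 x.2 s * V i.succ s)| ≤ ε := fun f => by
    refine le_trans ?_ (herr f g hg)
    rw [Finset.mul_sum]
    refine (Finset.abs_sum_le_sum_abs _ _).trans (Finset.sum_le_sum fun i _ => ?_)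
    rw [sum_occupancy_deterministicPolicy_mul, Finset.mul_sum]
    refine (Finset.abs_sum_le_sum_abs _ _).trans (Finset.sum_le_sum fun s _ => ?_)
    rw [hdev, abs_mul, abs_mul, abs_of_pos hcpos, abs_of_nonneg (occupancy_nonneg _ _ _ _ _)]
    exact le_of_eq (by ring)
  have h1 := hV.le_sum_init_sub G ν (deterministicPolicy f')
  have h2 := hV.sum_init_sub_eq G ν
  have h3 := abs_le.1 (habs f)
  have h4 := abs_le.1 (habs f')
  linarith [h3.2, h4.1]

end Guarantee

end

/-! ### The main theorem. -/

theorem mainTheorem3 :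
    ∃ c : ℝ, 0 < c ∧
      ∀ (S A : Type*) [Fintype S] [Nonempty S] [Fintype A] [Nonempty A] (H M : ℕ), 1 ≤ H →
        ∃ plan : (Fin M → Trajectory S A H) → (S → A → ℝ) → Policy S A H,
          ∀ (B : Type*) [Fintype B] (G : MarkovGame S A B) (ν : S → stdSimplex ℝ B)
            (κ : EntropyKind) (α β ε p R : ℝ) (ω : Fin H → Policy S A H),
            0 < α → α < 1 → β = α / (2 * (1 - α)) → 0 < ε → 0 < p → p < 1 → 0 < R →
            IsRenyiExploration G ν α ω →
            c * ((H : ℝ) ^ 2 * Fintype.card S * Fintype.card A / (ε / R)) ^ (2 * (β + 1))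
                * ((H : ℝ) / Fintype.card A)
                * Real.log ((Fintype.card S : ℝ) * Fintype.card A * H / (p * (ε / R)))
              ≤ (M : ℝ) →
            ∀ (Ω : Type*) [mΩ : MeasurableSpace Ω] (ℙ : MeasureTheory.Measure Ω)
              [MeasureTheory.IsProbabilityMeasure ℙ] (K : ℕ)
              (𝓜 : Ω → Fin M → Trajectory S A H) (obs : Ω → Fin K → S × B),
              @Measurable _ _ mΩ ⊤ 𝓜 → @Measurable _ _ mΩ ⊤ obs →
              (∀ δ, ℙ.real (𝓜 ⁻¹' {δ}) = datasetProb G ν ω δ) →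
              (∀ x s, empiricalEntropy κ (obs x) s ≤ R) →
              1 - p ≤ ℙ.real {x | ∃ πstar : Policy S A H,
                (∀ π : Policy S A H,
                  expectedReturn G ν (fun s _ => empiricalEntropy κ (obs x) s) π
                    ≤ expectedReturn G ν (fun s _ => empiricalEntropy κ (obs x) s) πstar) ∧
                expectedReturn G ν (fun s _ => empiricalEntropy κ (obs x) s) πstar
                  - expectedReturn G ν (fun s _ => empiricalEntropy κ (obs x) s)
                      (plan (𝓜 x) (fun s _ => empiricalEntropy κ (obs x) s)) ≤ 3 * ε} := by
  refine ⟨162, by norm_num, ?_⟩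
  intro S A _ _ _ _ H M hH
  obtain ⟨n, rfl⟩ : ∃ n, H = n + 1 := ⟨H - 1, by omega⟩
  choose f V hV using fun (δ : Fin M → Trajectory S A (n + 1)) (r : S → A → ℝ) =>
    exists_isBellmanOptimal (estimatedKernel δ) r
  refine ⟨fun δ r => deterministicPolicy (f δ r), ?_⟩
  intro B _ G ν κ α β ε p R ω hα0 hα1 hβ hε hp0 hp1 hR hω hM Ω _ ℙ _ K 𝓜 obs h𝓜 _ hlaw hobs
  have hr : ∀ x s (_ : A), empiricalEntropy κ (obs x) s ∈ Set.Icc 0 R := fun x s _ =>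
    ⟨empiricalEntropy_nonneg _ _ _, hobs x s⟩
  obtain ⟨good, hgood, hgood'⟩ := exists_good_datasets M G ν ω hp0 hp1
  have hprob : ℙ.real (𝓜 ⁻¹' (good : Set _)) = ∑ δ ∈ good, datasetProb G ν ω δ := by
    simp only [← hlaw]
    rw [MeasureTheory.sum_measureReal_preimage_singleton]
    exact fun δ _ => h𝓜 trivial
  rw [← hprob] at hgood
  -- The good event concerns the dataset alone and serves all rewards in [0, R] at once, so the
  -- joint law with the record is irrelevant.
  refine hgood.trans (MeasureTheory.measureReal_mono fun x hx => ?_)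
  obtain ⟨f', hf'⟩ := exists_deterministicPolicy_optimal G ν n
    (fun s (_ : A) => empiricalEntropy κ (obs x) s)
  refine ⟨deterministicPolicy f', hf', ?_⟩
  -- If HR ≤ 3ε, every policy is 3ε-optimal. Otherwise the regret is at most 2ε.
  rcases le_or_gt (((n + 1 : ℕ) : ℝ) * R) (3 * ε) with hsmall | hlarge
  · have h1 := (expectedReturn_mem_Icc G ν (hr x) (deterministicPolicy f')).2
    have h2 := (expectedReturn_mem_Icc G ν (hr x) (deterministicPolicy
      (f (𝓜 x) fun s _ => empiricalEntropy κ (obs x) s))).1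
    linarith
  · obtain ⟨hMpos, hbound⟩ := sample_size_bound (by exact_mod_cast hH)
      (by exact_mod_cast Fintype.card_pos) (by exact_mod_cast Fintype.card_pos) hε hR hα0 hα1 hβ
      hp0 hp1 hlarge hM
    have := regret_le_of_estimationError_le (f' := f') G ν (𝓜 x) hR (hr x) (hV _ _)
      fun f g hg => (mul_le_mul_of_nonneg_left (sum_occupancy_mul_abs_estimationError_le
        (by exact_mod_cast hMpos) hα0 hα1 hω (deterministicPolicy f) (fun i => f i.castSucc) hg
        (hgood' (𝓜 x) hx (fun i => f i.castSucc) g hg)) (by positivity)).trans hbound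
    linarith
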